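/- **Setting.** Let $\alpha\in(0,1)$, $\rho\in(0,1)$, $\theta\in(\alpha,\min\{\rho,1/2\})$ and $\mu_*=\min\{\rho,1-\rho\}$. Let $W:(0,\infty)^2\to\mathbb{R}$ be continuous, symmetric and homogeneous of degree zero with $0\le W(x,y)\le (x/y)^\alpha+(y/x)^\alpha$. Assume that $W(\cdot,1)$ has an analytic extension $V$ to $\mathbb{C}\setminus(-\infty,0]$ such that $\operatorname{Re}V(\xi)\ge 0$ whenever $\operatorname{Re}\xi\ge 0$, $V(\xi)=V(\xi^{-1})$ and $|V(\xi)|\le C(|\xi|^{-\alpha}+|\xi|^{\alpha})$. Let $V_\pm$ be the restrictions of $V$ to the half-planes $\mathbb{H}_\pm=\{\pm\operatorname{Im}\xi>0\}$. Assume that $V_\pm$ and $V_\pm'$ extend continuously to $\overline{\mathbb{H}_\pm}\setminus\{0\}$, that $|V_\pm'(z)|\le C(|z|^{-\alpha-1}+|z|^{\alpha-1})$ on $\mathbb{H}_\pm$, and that for some $h\in(0,1)$ and all $z_1,z_2\in\mathbb{H}_\pm$ with $|z_1-z_2|\le\frac12 m$, where $m=\min\{|z_1|,|z_2|\}$, $$|V_\pm'(z_1)-V_\pm'(z_2)|\le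 C|z_1-z_2|^{h}\begin{cases}m^{-\alpha-1-h}&\text{if } m\le 1,\\ m^{\alpha-1-h}&\text{if } m\ge 1.\end{cases}$$ Let $\Gamma$ be the representation kernel of $W$, i.e. the measure with $\frac{W(x,y)}{x+y}=\int_0^\infty\!\int_0^\infty\Gamma(\xi,\eta)e^{-\xi x-\eta y}\,d\xi\,d\eta$, which is given explicitly by $$\Gamma(\xi,\eta)=\frac1\xi\,\phi\Bigl(\frac{\eta}{\xi}\Bigr)+V_\pm(-1)\,\delta(\xi-\eta),\qquad \phi(s)=\frac{V_-(-s)-V_+(-s)}{2\pi i(1-s)}$$ (extended continuously to $s=1$). For real-valued $G,H\in C^2((0,\infty))\cap C([0,\infty))$ put $$N[G,H](r)=\frac1r\int_0^\infty\!\!\int_0^\infty\Gamma(\xi,\eta)\Bigl(G''(r+\xi)\bigl(H(\eta)-H(\eta+r)\bigr)+G'(r+\xi)\bigl(H'(\eta)-H'(\eta+r)\bigr)\Bigr)d\xi\,d\eta,$$ $$\mathcal{B}_W(G,H)(q)=\int_q^\infty\!\int_p^\infty N[G,H](r)\,dr\,dp .$$ For $\nu\ge0$ and $\chi>0$ let $$\|G\|_{2,\nu,\chi}=\sup_{q>0}(1+q)^{\chi}|G(q)|+\sum_{\ell=1}^{2}\sup_{q>0}(1+q)^{\chi+\nu+\rho}q^{\ell-\rho-\nu}|\partial_q^\ell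 G(q)|,$$ and let $X^2_{\nu,\chi}$ be the space of all $G\in C^2((0,\infty))\cap C([0,\infty))$ with $\|G\|_{2,\nu,\chi}<\infty$. **Proposition 3.3.** For every $\mu\in[0,\mu_*)$ there is a constant $C_\mu>0$ (which may depend on $\mu$ and on the fixed data $\alpha,\rho,\theta,W$, but not on $G,H$) such that for all $G,H\in X^2_{0,\theta}$ all integrals defining $\mathcal{B}_W(G,H)$ on $[0,\infty)$ converge absolutely, the function $\mathcal{B}_W(G,H)(\cdot)-\mathcal{B}_W(G,H)(\cdot+1)$ belongs to $X^2_{\mu,\theta}$, and $$\|\mathcal{B}_W(G,H)(\cdot)-\mathcal{B}_W(G,H)(\cdot+1)\|_{2,\mu,\theta}\le C_\mu\,\|G\|_{2,0,\theta}\,\|H\|_{2,0,\theta}.$$ -/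

import Mathlib

open Set MeasureTheory Filter Topology
open scoped ENNReal

noncomputable section

namespace FatTail

/-! ### Assumptions on the perturbation `W` -/

/-- The open upper half-plane. -/
def upperHP : Set ℂ := {z | 0 < z.im}

/-- The open lower half-plane. -/
def lowerHP : Set ℂ := {z | z.im < 0}

/-- `F`, restricted to the open half-plane `S`, extends as a `C¹` function to `closure S ∖ {0}`:
both `F` and its derivative have continuous extensions. -/
def ExtendsC1 (F : ℂ → ℂ) (S : Set ℂ) : Prop :=
  ∃ F₀ F₁ : ℂ → ℂ,
    ContinuousOn F₀ (closure S \ {0}) ∧ ContinuousOn F₁ (closure S \ {0}) ∧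
    EqOn F₀ F S ∧ EqOn F₁ (deriv F) S

/-- The local Hölder condition with exponent `h` on the derivative of `F` in the half-plane `S`. -/
def HolderDeriv (α h : ℝ) (F : ℂ → ℂ) (S : Set ℂ) : Prop :=
  ∃ C : ℝ, ∀ z₁ ∈ S, ∀ z₂ ∈ S, ‖z₁ - z₂‖ ≤ (1 / 2) * min ‖z₁‖ ‖z₂‖ →
    (min ‖z₁‖ ‖z₂‖ ≤ 1 →
      ‖deriv F z₁ - deriv F z₂‖ ≤ C * (min ‖z₁‖ ‖z₂‖) ^ (-α - 1 - h) * ‖z₁ - z₂‖ ^ h) ∧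
    (1 ≤ min ‖z₁‖ ‖z₂‖ →
      ‖deriv F z₁ - deriv F z₂‖ ≤ C * (min ‖z₁‖ ‖z₂‖) ^ (α - 1 - h) * ‖z₁ - z₂‖ ^ h)

/-- The assumptions on the perturbation `W` of the constant kernel. `V` is the analytic extension
of `x ↦ W(x, 1)` to the cut plane `ℂ ∖ (-∞, 0]` (its values on the cut play no role). -/
structure Admissible (α : ℝ) (W : ℝ → ℝ → ℝ) (V : ℂ → ℂ) : Prop where
  continuousOn : ContinuousOn (fun z : ℝ × ℝ => W z.1 z.2) (Ioi 0 ×ˢ Ioi 0)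
  symm : ∀ x y : ℝ, 0 < x → 0 < y → W x y = W y x
  homogeneous : ∀ t x y : ℝ, 0 < t → 0 < x → 0 < y → W (t * x) (t * y) = W x y
  nonneg : ∀ x y : ℝ, 0 < x → 0 < y → 0 ≤ W x y
  le : ∀ x y : ℝ, 0 < x → 0 < y → W x y ≤ (x / y) ^ α + (y / x) ^ α
  extends_W : ∀ x : ℝ, 0 < x → V (x : ℂ) = (W x 1 : ℂ)
  analytic : AnalyticOnNhd ℂ V Complex.slitPlane
  re_nonneg : ∀ z ∈ Complex.slitPlane, 0 ≤ z.re → 0 ≤ (V z).re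
  inv : ∀ z ∈ Complex.slitPlane, V z = V z⁻¹
  growth : ∃ C : ℝ, ∀ z ∈ Complex.slitPlane, ‖V z‖ ≤ C * (‖z‖ ^ (-α) + ‖z‖ ^ α)
  extendsC1_upper : ExtendsC1 V upperHP
  extendsC1_lower : ExtendsC1 V lowerHP
  holder : ∃ h : ℝ, 0 < h ∧ h < 1 ∧ HolderDeriv α h V upperHP ∧ HolderDeriv α h V lowerHP
  growth_deriv : ∃ C : ℝ, ∀ z ∈ upperHP ∪ lowerHP,
    ‖deriv V z‖ ≤ C * (‖z‖ ^ (-α - 1) + ‖z‖ ^ (α - 1))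

/-! ### The representation kernel

For admissible `W` one has
`W(x,y)/(x+y) = ∫∫ Γ(ξ,η) exp(-ξx-ηy) dξ dη` with
`Γ(ξ,η) = φ(η/ξ)/ξ + V(-1) δ(ξ-η)`, where `φ` is the jump of `V` across the cut, divided by
`2πi(1-s)`. By the reflection symmetry of `V`, the function `φ` and the number `V(-1)` are real
(so that taking real parts below changes nothing), and `V(-1)` is the same from both sides. -/

/-- `φ(s) = (V₋(-s) - V₊(-s)) / (2πi(1-s))`, where `V₊`, `V₋` are the boundary values of `V` from
the upper and the lower half-plane; at `s = 1` its continuous extension. -/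
def phi (V : ℂ → ℂ) (s : ℝ) : ℝ :=
  if s = 1 then
    ((extendFrom lowerHP (deriv V) (-1) - extendFrom upperHP (deriv V) (-1)) /
      (2 * (Real.pi : ℂ) * Complex.I)).re
  else
    ((extendFrom lowerHP V (-(s : ℂ)) - extendFrom upperHP V (-(s : ℂ))) /
      (2 * (Real.pi : ℂ) * Complex.I * (1 - (s : ℂ)))).re

/-- The absolutely continuous part of the representation kernel. -/
def kerTilde (V : ℂ → ℂ) (ξ η : ℝ) : ℝ := phi V (η / ξ) / ξ

/-- The coefficient `V(-1)` of the singular part `δ(ξ - η)` of the representation kernel. -/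
def diagCoeff (V : ℂ → ℂ) : ℝ := (extendFrom upperHP V (-1)).re

/-- `f` is absolutely integrable on `(0,∞)²` against the representation kernel. -/
def KerIntegrable (V : ℂ → ℂ) (f : ℝ → ℝ → ℝ) : Prop :=
  IntegrableOn (fun z : ℝ × ℝ => kerTilde V z.1 z.2 * f z.1 z.2) (Ioi 0 ×ˢ Ioi 0) ∧
  IntegrableOn (fun ξ : ℝ => f ξ ξ) (Ioi 0)

/-- `∫₀^∞ ∫₀^∞ Γ(ξ,η) f(ξ,η) dξ dη`; the part `δ(ξ - η)` integrates `f` along the diagonal. -/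
def kerIntegral (V : ℂ → ℂ) (f : ℝ → ℝ → ℝ) : ℝ :=
  (∫ z in (Ioi (0 : ℝ)) ×ˢ (Ioi (0 : ℝ)), kerTilde V z.1 z.2 * f z.1 z.2) +
    diagCoeff V * ∫ ξ in Ioi (0 : ℝ), f ξ ξ

/-! ### The bilinear form -/

/-- The integrand of `N₁[G,H](r)` (without the kernel). -/
def integrand₁ (G H : ℝ → ℝ) (r ξ η : ℝ) : ℝ :=
  iteratedDeriv 2 G (r + ξ) * (H η - H (η + r))

/-- The integrand of `N₂[G,H](r)` (without the kernel). -/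
def integrand₂ (G H : ℝ → ℝ) (r ξ η : ℝ) : ℝ :=
  deriv G (r + ξ) * (deriv H η - deriv H (η + r))

def N₁ (V : ℂ → ℂ) (G H : ℝ → ℝ) (r : ℝ) : ℝ := (1 / r) * kerIntegral V (integrand₁ G H r)

def N₂ (V : ℂ → ℂ) (G H : ℝ → ℝ) (r : ℝ) : ℝ := (1 / r) * kerIntegral V (integrand₂ G H r)

def N (V : ℂ → ℂ) (G H : ℝ → ℝ) (r : ℝ) : ℝ := N₁ V G H r + N₂ V G H r

/-- `𝓑_W(G,H)(q) = ∫_q^∞ ∫_p^∞ N[G,H](r) dr dp`. -/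
def BW (V : ℂ → ℂ) (G H : ℝ → ℝ) (q : ℝ) : ℝ :=
  ∫ p in Ioi q, ∫ r in Ioi p, N V G H r

/-- All integrals in the definition of `𝓑_W(G,H)(q)`, `q ≥ 0`, converge absolutely. -/
def BWWellDefined (V : ℂ → ℂ) (G H : ℝ → ℝ) : Prop :=
  (∀ r : ℝ, 0 < r → KerIntegrable V (integrand₁ G H r) ∧ KerIntegrable V (integrand₂ G H r)) ∧
  (∀ p : ℝ, 0 < p → IntegrableOn (N V G H) (Ioi p)) ∧
  IntegrableOn (fun p : ℝ => ∫ r in Ioi p, N V G H r) (Ioi 0)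

/-! ### Norms and spaces

Functions on `[0,∞)` are represented by functions on `ℝ`; values at negative arguments play no
role. -/

/-- `sup_{q>0} (1+q)^{χ+μ+ρ} q^{k-ρ-μ} |∂^k G(q)|`, with values in `[0,∞]`. -/
def seminormX (ρ : ℝ) (k : ℕ) (μ χ : ℝ) (G : ℝ → ℝ) : ℝ≥0∞ :=
  ⨆ q ∈ Ioi (0 : ℝ),
    ENNReal.ofReal ((1 + q) ^ (χ + μ + ρ) * q ^ ((k : ℝ) - ρ - μ) * |iteratedDeriv k G q|)

/-- The norm `‖G‖_{k,μ,χ}` for `k = 1, 2`, with values in `[0,∞]`. -/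
def normX (ρ : ℝ) (k : ℕ) (μ χ : ℝ) (G : ℝ → ℝ) : ℝ≥0∞ :=
  seminormX ρ 0 (-ρ) χ G + ∑ l ∈ Finset.Icc 1 k, seminormX ρ l μ χ G

/-- `X^k_{μ,χ}`: functions in `C^k((0,∞)) ∩ C([0,∞))` with finite norm. -/
def X (ρ : ℝ) (k : ℕ) (μ χ : ℝ) : Set (ℝ → ℝ) :=
  {G | ContDiffOn ℝ k G (Ioi 0) ∧ ContinuousOn G (Ici 0) ∧ normX ρ k μ χ G < ∞}

end FatTail

end

noncomputable section

namespace FatTail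

/-! ### Boundary values of `V` and bounds on the representation kernel -/

/-! The kernel enters only through a family of product bounds. Inversion exchanges the two boundary
values of `V`, so the jump across the cut at `-s` is `V₊(-1/s) - V₊(-s)`. It vanishes at `s = 1` at
a Lipschitz rate, which cancels the pole of `1/(1-s)`, and the growth of `V` controls small and
large `s`. Hence `|kerTilde V ξ η| ≤ C ξ^(a-1) η^(-a)` for every `a` in `[α, 1-α]`, with `a` free to
be chosen for each term. Against a product majorant the double integral splits into two Beta-type
integrals that scale like powers, and the diagonal part obeys the same power bound
(`Admissible.exists_kerIntegral_le`).

Up to the factor `1/r`, `N[G,H](r)` consists of three terms, with integrands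
`G''(r+ξ)(H(η)-H(η+r))`, `G'(r+ξ)H'(η)` and `-G'(r+ξ)H'(η+r)`. For all `r > 0` each is
`O(r^(ρ+μ-1))`; this is where `μ < min ρ (1-ρ)` is needed. For `r ≥ 1` the first and the third are
`O(r^(-1-θ))`. The second is only `O(r^(α-θ-1))`, because `H'` is not shifted and its integral does
not decrease with `r`.

Since `θ > α`, `N` can still be integrated twice, but the resulting decay falls short of `q^(-θ)` by
a factor `q^α`. The unit difference recovers it. For the function and its first derivative, the
difference is an integral over an interval of length one of the next derivative, which is smaller by
a full power, and `α < 1`. For the second derivative the increment of `N` itself is estimated: in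
the bad term the difference falls on `G'` and produces `G''`, and the increment of `1/r` also gains
a power (`Admissible.exists_abs_N_le_of_one_le`). `normX_tail_tail_sub_le` turns these bounds on `N`
into the norm estimate. -/

lemma closure_upperHP : closure upperHP = {z : ℂ | 0 ≤ z.im} := Complex.closure_setOfPred_lt_im 0

lemma closure_lowerHP : closure lowerHP = {z : ℂ | z.im ≤ 0} := Complex.closure_setOfPred_im_lt 0

lemma upperHP_subset_slitPlane : upperHP ⊆ Complex.slitPlane := fun _ hz => Or.inr (ne_of_gt hz)

lemma neg_ofReal_mem_closure_upperHP (s : ℝ) : (-(s : ℂ)) ∈ closure upperHP := by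
  rw [closure_upperHP]; simp

lemma neg_ofReal_mem_closure_lowerHP (s : ℝ) : (-(s : ℂ)) ∈ closure lowerHP := by
  rw [closure_lowerHP]; simp

lemma ExtendsC1.exists_boundary {F : ℂ → ℂ} {S : Set ℂ} (h : ExtendsC1 F S) (h0 : (0 : ℂ) ∉ S) :
    ∃ F₀ : ℂ → ℂ, ContinuousOn F₀ (closure S \ {0}) ∧
      ∀ z ∈ closure S \ {0}, Tendsto F (𝓝[S] z) (𝓝 (F₀ z)) ∧ extendFrom S F z = F₀ z := by
  obtain ⟨F₀, F₁, hF₀, -, hEq, -⟩ := h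
  refine ⟨F₀, hF₀, fun z hz => ?_⟩
  have hsub : S ⊆ closure S \ {0} := fun w hw => ⟨subset_closure hw, fun h => h0 (h ▸ hw)⟩
  have ht : Tendsto F (𝓝[S] z) (𝓝 (F₀ z)) := by
    refine ((hF₀ z hz).mono_left (nhdsWithin_mono z hsub)).congr' ?_
    filter_upwards [self_mem_nhdsWithin] with w hw using hEq hw
  exact ⟨ht, extendFrom_eq hz.1 ht⟩

variable {α : ℝ} {W : ℝ → ℝ → ℝ} {V : ℂ → ℂ}

lemma neg_ofReal_ne_zero {s : ℝ} (hs : 0 < s) : (-(s : ℂ)) ≠ 0 := by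
  simpa using hs.ne'

lemma Admissible.tendsto_upper (hW : Admissible α W V) {s : ℝ} (hs : 0 < s) :
    Tendsto V (𝓝[upperHP] (-(s : ℂ))) (𝓝 (extendFrom upperHP V (-(s : ℂ)))) := by
  obtain ⟨F₀, -, h⟩ := hW.extendsC1_upper.exists_boundary (by simp [upperHP])
  obtain ⟨h1, h2⟩ := h _ ⟨neg_ofReal_mem_closure_upperHP s, neg_ofReal_ne_zero hs⟩
  rwa [h2]

lemma Admissible.tendsto_lower (hW : Admissible α W V) {s : ℝ} (hs : 0 < s) :
    Tendsto V (𝓝[lowerHP] (-(s : ℂ))) (𝓝 (extendFrom lowerHP V (-(s : ℂ)))) := by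
  obtain ⟨F₀, -, h⟩ := hW.extendsC1_lower.exists_boundary (by simp [lowerHP])
  obtain ⟨h1, h2⟩ := h _ ⟨neg_ofReal_mem_closure_lowerHP s, neg_ofReal_ne_zero hs⟩
  rwa [h2]

lemma ExtendsC1.continuousOn_extendFrom {F : ℂ → ℂ} {S : Set ℂ} (h : ExtendsC1 F S)
    (h0 : (0 : ℂ) ∉ S) (hS : ∀ s : ℝ, (-(s : ℂ)) ∈ closure S) :
    ContinuousOn (fun s : ℝ => extendFrom S F (-(s : ℂ))) (Ioi 0) := by
  obtain ⟨F₀, hF₀, h⟩ := h.exists_boundary h0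
  have hm : ∀ s ∈ Ioi (0 : ℝ), (-(s : ℂ)) ∈ closure S \ {0} :=
    fun s hs => ⟨hS s, neg_ofReal_ne_zero hs⟩
  refine (hF₀.comp (f := fun s : ℝ => -(s : ℂ)) (by fun_prop) hm).congr fun s hs => ?_
  exact (h _ (hm s hs)).2

/-- The two boundary values are exchanged by inversion. -/
lemma Admissible.extendFrom_lower (hW : Admissible α W V) {s : ℝ} (hs : 0 < s) :
    extendFrom lowerHP V (-(s : ℂ)) = extendFrom upperHP V (-((s⁻¹ : ℝ) : ℂ)) := by
  have hne : NeBot (𝓝[upperHP] (-((s⁻¹ : ℝ) : ℂ))) :=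
    mem_closure_iff_nhdsWithin_neBot.1 (neg_ofReal_mem_closure_upperHP _)
  refine tendsto_nhds_unique ?_ (hW.tendsto_upper (inv_pos.2 hs))
  have h1 : Tendsto (fun z : ℂ => z⁻¹) (𝓝[upperHP] (-((s⁻¹ : ℝ) : ℂ)))
      (𝓝[lowerHP] (-(s : ℂ))) := by
    refine tendsto_nhdsWithin_iff.2 ⟨?_, ?_⟩
    · have h2 : (-(s : ℂ)) = (-((s⁻¹ : ℝ) : ℂ))⁻¹ := by
        push_cast; rw [inv_neg, inv_inv]
      rw [h2]
      exact (tendsto_inv₀ (neg_ofReal_ne_zero (inv_pos.2 hs))).mono_left nhdsWithin_le_nhds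
    · filter_upwards [self_mem_nhdsWithin] with z hz
      have hz' : 0 < z.im := hz
      have hz0 : z ≠ 0 := fun h => by simp [h] at hz'
      change (z⁻¹).im < 0
      rw [Complex.inv_im]
      exact div_neg_of_neg_of_pos (by linarith) (Complex.normSq_pos.2 hz0)
  refine ((hW.tendsto_lower hs).comp h1).congr' ?_
  filter_upwards [self_mem_nhdsWithin] with z hz
  exact (hW.inv z (upperHP_subset_slitPlane hz)).symm

lemma Admissible.exists_norm_upper_le (hW : Admissible α W V) :
    ∃ C : ℝ, 0 ≤ C ∧ ∀ s : ℝ, 0 < s →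
      ‖extendFrom upperHP V (-(s : ℂ))‖ ≤ C * (s ^ (-α) + s ^ α) := by
  obtain ⟨C, hC⟩ := hW.growth
  refine ⟨|C|, abs_nonneg _, fun s hs => ?_⟩
  have hne : NeBot (𝓝[upperHP] (-(s : ℂ))) :=
    mem_closure_iff_nhdsWithin_neBot.1 (neg_ofReal_mem_closure_upperHP _)
  have hn : Tendsto (fun z : ℂ => ‖z‖) (𝓝[upperHP] (-(s : ℂ))) (𝓝 s) := by
    have : Tendsto (fun z : ℂ => ‖z‖) (𝓝 (-(s : ℂ))) (𝓝 ‖-(s : ℂ)‖) := continuous_norm.tendsto _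
    rw [norm_neg, Complex.norm_real, Real.norm_of_nonneg hs.le] at this
    exact this.mono_left nhdsWithin_le_nhds
  refine le_of_tendsto_of_tendsto (hW.tendsto_upper hs).norm
    (((hn.rpow_const (Or.inl hs.ne')).add (hn.rpow_const (Or.inl hs.ne'))).const_mul |C|) ?_
  filter_upwards [self_mem_nhdsWithin] with z hz
  refine (hC z (upperHP_subset_slitPlane hz)).trans ?_
  gcongr
  exact le_abs_self C

/-- The bound on `V'` is uniform away from the origin, so the mean value inequality on a convex
region of the upper half-plane gives a Lipschitz bound that survives the passage to the cut. -/
lemma Admissible.exists_lipschitz_upper (hα : α ∈ Ioo (0 : ℝ) 1) (hW : Admissible α W V) :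
    ∃ L : ℝ, 0 ≤ L ∧ ∀ s s' : ℝ, 1 / 2 ≤ s → 1 / 2 ≤ s' →
      ‖extendFrom upperHP V (-(s : ℂ)) - extendFrom upperHP V (-(s' : ℂ))‖ ≤ L * |s - s'| := by
  obtain ⟨C, hC⟩ := hW.growth_deriv
  obtain ⟨hα0, hα1⟩ := hα
  set L : ℝ := |C| * ((1 / 4 : ℝ) ^ (-α - 1) + (1 / 4 : ℝ) ^ (α - 1)) with hL
  refine ⟨L, by positivity, fun s s' hs hs' => ?_⟩
  -- Convex, at distance at least `1/4` from the origin, and containing `-s + iε` for every `s ≥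
  -- 1/2` and `ε > 0`.
  set D : Set ℂ := {z | 0 < z.im} ∩ {z | z.re < -(1 / 4)} with hD
  have hconv : Convex ℝ D := (convex_halfSpace_im_gt 0).inter (convex_halfSpace_re_lt _)
  have hlip : ∀ x ∈ D, ∀ y ∈ D, ‖V y - V x‖ ≤ L * ‖y - x‖ := by
    intro x hx y hy
    refine hconv.norm_image_sub_le_of_norm_deriv_le (𝕜 := ℂ) (fun z hz => ?_) (fun z hz => ?_)
      hx hy
    · exact (hW.analytic z (upperHP_subset_slitPlane hz.1)).differentiableAt
    · have hz4 : (1 / 4 : ℝ) ≤ ‖z‖ := by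
        have h1 : |z.re| ≤ ‖z‖ := Complex.abs_re_le_norm z
        have h2 : z.re < -(1 / 4) := hz.2
        have h3 := neg_abs_le z.re
        linarith
      refine (hC z (Or.inl hz.1)).trans ?_
      rw [hL]
      have e1 : ‖z‖ ^ (-α - 1) ≤ (1 / 4 : ℝ) ^ (-α - 1) :=
        Real.rpow_le_rpow_of_nonpos (by norm_num) hz4 (by linarith)
      have e2 : ‖z‖ ^ (α - 1) ≤ (1 / 4 : ℝ) ^ (α - 1) :=
        Real.rpow_le_rpow_of_nonpos (by norm_num) hz4 (by linarith)
      gcongr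
      exact le_abs_self C
  have hpath : ∀ t : ℝ, Tendsto (fun ε : ℝ => -(t : ℂ) + (ε : ℂ) * Complex.I) (𝓝[>] 0)
      (𝓝[upperHP] (-(t : ℂ))) := by
    intro t
    refine tendsto_nhdsWithin_iff.2 ⟨?_, ?_⟩
    · have : Continuous fun ε : ℝ => -(t : ℂ) + (ε : ℂ) * Complex.I := by fun_prop
      simpa using (this.tendsto 0).mono_left (nhdsWithin_le_nhds (s := Ioi 0))
    · filter_upwards [self_mem_nhdsWithin] with ε hε
      simpa [upperHP] using hε
  have h1 := (hW.tendsto_upper (s := s) (by linarith)).comp (hpath s)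
  have h2 := (hW.tendsto_upper (s := s') (by linarith)).comp (hpath s')
  refine le_of_tendsto (h1.sub h2).norm ?_
  filter_upwards [self_mem_nhdsWithin] with ε hε
  have hε' : 0 < ε := hε
  have := hlip (-(s' : ℂ) + (ε : ℂ) * Complex.I) ⟨by simpa using hε', by simp; linarith⟩
    (-(s : ℂ) + (ε : ℂ) * Complex.I) ⟨by simpa using hε', by simp; linarith⟩
  refine this.trans (le_of_eq ?_)
  congr 1
  have : -(s : ℂ) + (ε : ℂ) * Complex.I - (-(s' : ℂ) + (ε : ℂ) * Complex.I)
      = ((s' - s : ℝ) : ℂ) := by push_cast; ring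
  rw [this, Complex.norm_real, Real.norm_eq_abs, abs_sub_comm]

lemma abs_phi_le_of_ne (V : ℂ → ℂ) {s : ℝ} (hs : s ≠ 1) :
    |phi V s| ≤ ‖extendFrom lowerHP V (-(s : ℂ)) - extendFrom upperHP V (-(s : ℂ))‖ / |1 - s| := by
  rw [phi, if_neg hs]
  refine (Complex.abs_re_le_norm _).trans ?_
  have h1 : ‖(2 * (Real.pi : ℂ) * Complex.I * (1 - (s : ℂ)))‖ = 2 * Real.pi * |1 - s| := by
    have : (1 - (s : ℂ)) = ((1 - s : ℝ) : ℂ) := by push_cast; ring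
    rw [this, norm_mul, norm_mul, norm_mul, Complex.norm_real, Complex.norm_real, Complex.norm_I,
      Real.norm_of_nonneg Real.pi_pos.le, Real.norm_eq_abs]
    simp
  rw [norm_div, h1]
  have h2 : 0 < |1 - s| := abs_pos.2 (sub_ne_zero.2 hs.symm)
  gcongr
  nlinarith [Real.pi_gt_three]

/-- The density `φ` is bounded by every power `s ↦ s⁻ᵃ` with `α ≤ a ≤ 1 - α`. -/
lemma Admissible.exists_abs_phi_le (hα : α ∈ Ioo (0 : ℝ) 1) (hW : Admissible α W V) :
    ∃ C : ℝ, 0 ≤ C ∧ ∀ a ∈ Icc α (1 - α), ∀ s : ℝ, 0 < s → |phi V s| ≤ C * s ^ (-a) := by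
  obtain ⟨C, hC0, hC⟩ := hW.exists_norm_upper_le
  obtain ⟨L, hL0, hL⟩ := hW.exists_lipschitz_upper hα
  obtain ⟨hα0, hα1⟩ := hα
  -- One summand per regime: `8C` for `s < 1/2` and `s > 2`, `6L` for `s` in `[1/2, 2]` apart from
  -- `1`, and the last one for `s = 1`. On `[1/2, 2]` the power `s^(-a)` is at least `1/2`.
  refine ⟨8 * C + 6 * L + 2 * |phi V 1|, by positivity, fun a ha s hs => ?_⟩
  have hpos : 0 < s ^ (-a) := Real.rpow_pos_of_pos hs _
  have hJ : ‖extendFrom lowerHP V (-(s : ℂ)) - extendFrom upperHP V (-(s : ℂ))‖ ≤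
      2 * C * (s ^ (-α) + s ^ α) := by
    refine (norm_sub_le _ _).trans ?_
    rw [hW.extendFrom_lower hs]
    have h1 := hC s⁻¹ (inv_pos.2 hs)
    rw [Real.inv_rpow hs.le, Real.inv_rpow hs.le, ← Real.rpow_neg hs.le, ← Real.rpow_neg hs.le,
      neg_neg] at h1
    linarith [hC s hs]
  have h6L : 0 ≤ 6 * L * s ^ (-a) := by positivity
  have h8C : 0 ≤ 8 * C * s ^ (-a) := by positivity
  have hp1 : 0 ≤ 2 * |phi V 1| * s ^ (-a) := by positivity
  rcases lt_or_ge s (1 / 2) with hlt | hge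
  · have hden : 1 / 2 ≤ |1 - s| := by rw [abs_of_pos] <;> linarith
    have e1 : s ^ (-α) ≤ s ^ (-a) :=
      Real.rpow_le_rpow_of_exponent_ge hs (by linarith) (by linarith [ha.1])
    have e2 : s ^ α ≤ s ^ (-a) :=
      Real.rpow_le_rpow_of_exponent_ge hs (by linarith) (by linarith [ha.1])
    have h1 := abs_phi_le_of_ne V (s := s) (by linarith)
    have h2 : ‖extendFrom lowerHP V (-(s : ℂ)) - extendFrom upperHP V (-(s : ℂ))‖ / |1 - s| ≤
        2 * C * (s ^ (-a) + s ^ (-a)) / (1 / 2) := by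
      gcongr
      exact hJ.trans (by gcongr)
    linarith
  rcases lt_or_ge 2 s with hlt | hle
  · have hden : s / 2 ≤ |1 - s| := by rw [abs_of_neg] <;> linarith
    have e0 : s ^ α = s ^ (α - 1) * s := by
      rw [← Real.rpow_add_one hs.ne']; ring_nf
    have e1 : s ^ (α - 1) ≤ s ^ (-a) :=
      Real.rpow_le_rpow_of_exponent_le (by linarith) (by linarith [ha.2])
    have e2 : s ^ (-α) ≤ s ^ α :=
      Real.rpow_le_rpow_of_exponent_le (by linarith) (by linarith)
    have h1 := abs_phi_le_of_ne V (s := s) (by linarith)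
    have h2 : ‖extendFrom lowerHP V (-(s : ℂ)) - extendFrom upperHP V (-(s : ℂ))‖ / |1 - s| ≤
        2 * C * (s ^ (-a) * s + s ^ (-a) * s) / (s / 2) := by
      have e3 : s ^ α ≤ s ^ (-a) * s := by rw [e0]; gcongr
      gcongr
      exact hJ.trans (by gcongr; exact e2.trans e3)
    have h3 : 2 * C * (s ^ (-a) * s + s ^ (-a) * s) / (s / 2) = 8 * C * s ^ (-a) := by
      field_simp; ring
    linarith
  · have hlow : 1 / 2 ≤ s ^ (-a) := by
      have h1 : (2 : ℝ) ^ (-a) ≤ s ^ (-a) :=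
        Real.rpow_le_rpow_of_nonpos hs hle (by linarith [ha.1])
      have h2 : (2 : ℝ) ^ (-1 : ℝ) ≤ 2 ^ (-a) :=
        Real.rpow_le_rpow_of_exponent_le (by norm_num) (by linarith [ha.2])
      rw [Real.rpow_neg_one] at h2
      linarith
    rcases eq_or_ne s 1 with rfl | hne
    · have : |phi V 1| ≤ 2 * |phi V 1| * (1 : ℝ) ^ (-a) := by
        rw [Real.one_rpow]; linarith [abs_nonneg (phi V 1)]
      linarith
    · have h1 := abs_phi_le_of_ne V hne
      have hd : 0 < |1 - s| := abs_pos.2 (sub_ne_zero.2 hne.symm)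
      have hinv : 1 / 2 ≤ s⁻¹ := by
        rw [one_div]; exact inv_anti₀ hs hle
      have hinv2 : s⁻¹ ≤ 2 := by
        rw [inv_le_comm₀ hs (by norm_num)]; linarith
      have h2 := hL s⁻¹ s hinv hge
      -- The factor `1 - s` cancels the denominator of `φ`.
      have h3 : s⁻¹ - s = (1 - s) * (1 + s⁻¹) := by field_simp; ring
      rw [h3, abs_mul, abs_of_pos (show 0 < 1 + s⁻¹ by linarith)] at h2
      rw [hW.extendFrom_lower hs] at h1
      have h4 : |phi V s| ≤ 3 * L := by
        refine h1.trans ((div_le_iff₀ hd).2 (h2.trans ?_))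
        have : |1 - s| * (1 + s⁻¹) ≤ |1 - s| * 3 := by gcongr; linarith
        nlinarith
      nlinarith

lemma Admissible.exists_abs_kerTilde_le (hα : α ∈ Ioo (0 : ℝ) 1) (hW : Admissible α W V) :
    ∃ C : ℝ, 0 ≤ C ∧ ∀ a ∈ Icc α (1 - α), ∀ ξ η : ℝ, 0 < ξ → 0 < η →
      |kerTilde V ξ η| ≤ C * (ξ ^ (a - 1) * η ^ (-a)) := by
  obtain ⟨C, hC0, hC⟩ := hW.exists_abs_phi_le hα
  refine ⟨C, hC0, fun a ha ξ η hξ hη => ?_⟩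
  rw [kerTilde, abs_div, abs_of_pos hξ, div_le_iff₀ hξ]
  refine (hC a ha _ (div_pos hη hξ)).trans (le_of_eq ?_)
  rw [Real.div_rpow hη.le hξ.le, Real.rpow_sub_one hξ.ne', Real.rpow_neg hξ.le,
    div_inv_eq_mul]
  field_simp

lemma Admissible.measurable_indicator_phi (hW : Admissible α W V) :
    Measurable ((Ioi (0 : ℝ)).indicator (phi V)) := by
  have hu := (hW.extendsC1_upper.continuousOn_extendFrom (by simp [upperHP])
    neg_ofReal_mem_closure_upperHP).measurable_piecewise
      (g := fun _ => (0 : ℂ)) continuousOn_const measurableSet_Ioi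
  have hl := (hW.extendsC1_lower.continuousOn_extendFrom (by simp [lowerHP])
    neg_ofReal_mem_closure_lowerHP).measurable_piecewise
      (g := fun _ => (0 : ℂ)) continuousOn_const measurableSet_Ioi
  have hg : Measurable fun s : ℝ => (((Ioi (0 : ℝ)).piecewise
        (fun s : ℝ => extendFrom lowerHP V (-(s : ℂ))) (fun _ => (0 : ℂ)) s -
      (Ioi (0 : ℝ)).piecewise
        (fun s : ℝ => extendFrom upperHP V (-(s : ℂ))) (fun _ => (0 : ℂ)) s) /
      (2 * (Real.pi : ℂ) * Complex.I * (1 - (s : ℂ)))).re :=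
    Complex.measurable_re.comp
      ((hl.sub hu).div ((measurable_const.sub Complex.measurable_ofReal).const_mul _))
  have hi : Measurable fun s : ℝ => if s = 1 then phi V 1 else _ :=
    Measurable.ite (p := fun s : ℝ => s = 1) (measurableSet_singleton 1) measurable_const hg
  refine (congrArg Measurable (indicator_congr fun s hs => ?_)).mp
    (hi.indicator (measurableSet_Ioi (a := (0 : ℝ))))
  by_cases h : s = 1
  · simp [h]
  · simp only [h, if_false, phi, piecewise_eq_of_mem _ _ _ hs]

lemma Admissible.aestronglyMeasurable_kerTilde (hW : Admissible α W V) :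
    AEStronglyMeasurable (fun z : ℝ × ℝ => kerTilde V z.1 z.2)
      (volume.restrict (Ioi (0 : ℝ) ×ˢ Ioi (0 : ℝ))) := by
  have h1 : Measurable fun z : ℝ × ℝ => (Ioi (0 : ℝ)).indicator (phi V) (z.2 / z.1) / z.1 :=
    (hW.measurable_indicator_phi.comp (measurable_snd.div measurable_fst)).div measurable_fst
  refine h1.aestronglyMeasurable.congr ?_
  filter_upwards [ae_restrict_mem (measurableSet_Ioi.prod measurableSet_Ioi)] with z hz
  rw [kerTilde, indicator_of_mem (mem_Ioi.2 (div_pos hz.2 hz.1))]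

/-! ### Power integrals -/

lemma integrableOn_rpow_mul_add_rpow {s b r : ℝ} (hs : 0 < s) (hsb : s + b < 0) (hr : 0 < r) :
    IntegrableOn (fun ξ : ℝ => ξ ^ (s - 1) * (r + ξ) ^ b) (Ioi 0) := by
  have hmeas : ∀ S ⊆ Ioi (0 : ℝ), MeasurableSet S → AEStronglyMeasurable
      (fun ξ : ℝ => ξ ^ (s - 1) * (r + ξ) ^ b) (volume.restrict S) := by
    intro S hS hm
    refine ContinuousOn.aestronglyMeasurable (fun ξ hξ => ContinuousAt.continuousWithinAt ?_) hm
    have h0 : 0 < ξ := hS hξ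
    exact (continuousAt_id.rpow_const (Or.inl h0.ne')).mul
      ((continuousAt_const.add continuousAt_id).rpow_const (Or.inl (add_pos hr h0).ne'))
  rw [← Ioc_union_Ioi_eq_Ioi zero_le_one]
  refine IntegrableOn.union ?_ ?_
  · have h1 : IntegrableOn (fun ξ : ℝ => ξ ^ (s - 1) * r ^ b) (Ioc 0 1) := by
      refine Integrable.mul_const ?_ _
      exact (intervalIntegrable_iff_integrableOn_Ioc_of_le zero_le_one).1
        (intervalIntegral.intervalIntegrable_rpow' (by linarith))
    refine h1.mono' (hmeas _ Ioc_subset_Ioi_self measurableSet_Ioc) ?_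
    filter_upwards [ae_restrict_mem measurableSet_Ioc] with ξ hξ
    have h0 : 0 < ξ := hξ.1
    rw [Real.norm_of_nonneg (by positivity)]
    gcongr ?_ * ?_
    exact Real.rpow_le_rpow_of_nonpos hr (by linarith) (by linarith)
  · have h1 : IntegrableOn (fun ξ : ℝ => ξ ^ (s - 1 + b)) (Ioi 1) :=
      integrableOn_Ioi_rpow_of_lt (by linarith) zero_lt_one
    refine h1.mono' (hmeas _ (Ioi_subset_Ioi zero_le_one) measurableSet_Ioi) ?_
    filter_upwards [ae_restrict_mem measurableSet_Ioi] with ξ hξ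
    have h0 : 0 < ξ := zero_lt_one.trans hξ
    rw [Real.norm_of_nonneg (by positivity), Real.rpow_add h0]
    gcongr ?_ * ?_
    exact Real.rpow_le_rpow_of_nonpos h0 (by linarith) (by linarith)

/-- Substitution `ξ ↦ rξ`. The remaining Beta-type integral is never evaluated; only the power of
`r` matters. -/
lemma integral_rpow_mul_add_rpow {s b r : ℝ} (hr : 0 < r) :
    ∫ ξ in Ioi (0 : ℝ), ξ ^ (s - 1) * (r + ξ) ^ b =
      r ^ (s + b) * ∫ ξ in Ioi (0 : ℝ), ξ ^ (s - 1) * (1 + ξ) ^ b := by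
  have h := integral_comp_mul_left_Ioi (fun ξ : ℝ => ξ ^ (s - 1) * (r + ξ) ^ b) 0 hr
  rw [mul_zero, smul_eq_mul, eq_inv_mul_iff_mul_eq₀ hr.ne'] at h
  rw [← h, ← integral_const_mul, ← integral_const_mul]
  refine setIntegral_congr_fun measurableSet_Ioi fun ξ hξ => ?_
  have h0 : 0 < ξ := hξ
  have e : r + r * ξ = r * (1 + ξ) := by ring
  have e2 : s + b = 1 + (s - 1) + b := by ring
  rw [e, Real.mul_rpow hr.le h0.le, Real.mul_rpow hr.le (by positivity), e2, Real.rpow_add hr,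
    Real.rpow_add hr, Real.rpow_one]
  ring

/-! ### Integration against the representation kernel -/

/-- The diagonal part of a product majorant. -/
lemma diag_majorant_le {a b c t r σ ξ : ℝ} (h1 : 0 < 1 - a - t) (h2 : 1 - a - t + c < 0)
    (hr : 0 < r) (hσ : 0 < σ) (hξ : 0 < ξ) :
    (r + ξ) ^ b * (ξ ^ (-t) * (σ + ξ) ^ c) ≤
      σ ^ (1 - a - t + c) * (ξ ^ (a - 1) * (r + ξ) ^ b) := by
  -- Splitting off `ξ^(a-1)` leaves the `ξ`-integral of the off-diagonal part, and the rest is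
  -- bounded by its value at scale `σ`. Both parts therefore scale alike.
  have e : ξ ^ (-t) = ξ ^ (a - 1) * ξ ^ (1 - a - t) := by
    rw [← Real.rpow_add hξ]; congr 1; ring
  have h3 : ξ ^ (1 - a - t) * (σ + ξ) ^ c ≤ σ ^ (1 - a - t + c) :=
    calc ξ ^ (1 - a - t) * (σ + ξ) ^ c ≤ (σ + ξ) ^ (1 - a - t) * (σ + ξ) ^ c := by
          gcongr; linarith
      _ = (σ + ξ) ^ (1 - a - t + c) := (Real.rpow_add (by linarith) _ _).symm
      _ ≤ σ ^ (1 - a - t + c) := Real.rpow_le_rpow_of_nonpos hσ (by linarith) h2.le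
  calc (r + ξ) ^ b * (ξ ^ (-t) * (σ + ξ) ^ c)
      = (ξ ^ (a - 1) * (r + ξ) ^ b) * (ξ ^ (1 - a - t) * (σ + ξ) ^ c) := by rw [e]; ring
    _ ≤ (ξ ^ (a - 1) * (r + ξ) ^ b) * σ ^ (1 - a - t + c) := by gcongr
    _ = _ := mul_comm _ _

/-- The off-diagonal part of a product majorant. -/
lemma offdiag_majorant_le {a b c t r σ C M k x ξ η : ℝ} (hC : 0 ≤ C) (hξ : 0 < ξ) (hη : 0 < η)
    (hk : |k| ≤ C * (ξ ^ (a - 1) * η ^ (-a)))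
    (hx : |x| ≤ M * ((r + ξ) ^ b * (η ^ (-t) * (σ + η) ^ c))) :
    ‖k * x‖ ≤ C * M * ((ξ ^ (a - 1) * (r + ξ) ^ b) *
      (η ^ (1 - a - t - 1) * (σ + η) ^ c)) := by
  have e : η ^ (1 - a - t - 1) = η ^ (-a) * η ^ (-t) := by
    rw [← Real.rpow_add hη]; congr 1; ring
  rw [Real.norm_eq_abs, abs_mul, e]
  calc |k| * |x| ≤ (C * (ξ ^ (a - 1) * η ^ (-a))) *
        (M * ((r + ξ) ^ b * (η ^ (-t) * (σ + η) ^ c))) := by gcongr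
    _ = _ := by ring

lemma integrableOn_offdiag_majorant {a b c t r σ : ℝ} (ha : 0 < a) (hab : a + b < 0)
    (h1 : 0 < 1 - a - t) (h2 : 1 - a - t + c < 0) (hr : 0 < r) (hσ : 0 < σ) :
    IntegrableOn (fun z : ℝ × ℝ => (z.1 ^ (a - 1) * (r + z.1) ^ b) *
      (z.2 ^ (1 - a - t - 1) * (σ + z.2) ^ c)) (Ioi 0 ×ˢ Ioi 0) := by
  rw [IntegrableOn, Measure.volume_eq_prod, ← Measure.prod_restrict]
  exact (integrableOn_rpow_mul_add_rpow ha hab hr).mul_prod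
    (integrableOn_rpow_mul_add_rpow h1 h2 hσ)

lemma continuousOn_diag {f : ℝ → ℝ → ℝ}
    (hf : ContinuousOn (fun z : ℝ × ℝ => f z.1 z.2) (Ioi 0 ×ˢ Ioi 0)) :
    ContinuousOn (fun ξ : ℝ => f ξ ξ) (Ioi 0) :=
  hf.comp (f := fun ξ : ℝ => (ξ, ξ)) (by fun_prop) fun _ h => ⟨h, h⟩

/-- Functions with a product majorant are integrable against the representation kernel, with
a bound that scales like the majorant. -/
lemma Admissible.exists_kerIntegral_le (hα : α ∈ Ioo (0 : ℝ) 1) (hW : Admissible α W V)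
    {a b c t : ℝ} (ha : a ∈ Icc α (1 - α)) (hab : a + b < 0)
    (h1 : 0 < 1 - a - t) (h2 : 1 - a - t + c < 0) :
    ∃ C : ℝ, 0 ≤ C ∧ ∀ r σ M : ℝ, 0 < r → 0 < σ → ∀ f : ℝ → ℝ → ℝ,
      ContinuousOn (fun z : ℝ × ℝ => f z.1 z.2) (Ioi 0 ×ˢ Ioi 0) →
      (∀ ξ η : ℝ, 0 < ξ → 0 < η →
        |f ξ η| ≤ M * ((r + ξ) ^ b * (η ^ (-t) * (σ + η) ^ c))) →
      KerIntegrable V f ∧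
        |kerIntegral V f| ≤ C * M * (r ^ (a + b) * σ ^ (1 - a - t + c)) := by
  obtain ⟨C, hC0, hC⟩ := hW.exists_abs_kerTilde_le hα
  have ha0 : 0 < a := hα.1.trans_le ha.1
  set I₁ : ℝ := ∫ ξ in Ioi (0 : ℝ), ξ ^ (a - 1) * (1 + ξ) ^ b with hI₁
  set I₂ : ℝ := ∫ ξ in Ioi (0 : ℝ), ξ ^ (1 - a - t - 1) * (1 + ξ) ^ c with hI₂
  have hI₁0 : 0 ≤ I₁ := setIntegral_nonneg measurableSet_Ioi fun ξ hξ => by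
    have : 0 < ξ := hξ
    positivity
  have hI₂0 : 0 ≤ I₂ := setIntegral_nonneg measurableSet_Ioi fun ξ hξ => by
    have : 0 < ξ := hξ
    positivity
  refine ⟨C * (I₁ * I₂) + |diagCoeff V| * I₁, by positivity, fun r σ M hr hσ f hf hfM => ?_⟩
  have hM : 0 ≤ M := by
    have := (abs_nonneg _).trans (hfM 1 1 one_pos one_pos)
    exact nonneg_of_mul_nonneg_left this (by positivity)
  have hm : MeasurableSet (Ioi (0 : ℝ) ×ˢ Ioi (0 : ℝ)) := measurableSet_Ioi.prod measurableSet_Ioi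
  have hoff := (integrableOn_offdiag_majorant ha0 hab h1 h2 hr hσ).const_mul (C * M)
  have hoffle : ∀ᵐ z : ℝ × ℝ ∂(volume.restrict (Ioi (0 : ℝ) ×ˢ Ioi (0 : ℝ))),
      ‖kerTilde V z.1 z.2 * f z.1 z.2‖ ≤ C * M * ((z.1 ^ (a - 1) * (r + z.1) ^ b) *
        (z.2 ^ (1 - a - t - 1) * (σ + z.2) ^ c)) := by
    filter_upwards [ae_restrict_mem hm] with z hz
    exact offdiag_majorant_le hC0 hz.1 hz.2 (hC a ha _ _ hz.1 hz.2) (hfM _ _ hz.1 hz.2)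
  have hdia := (integrableOn_rpow_mul_add_rpow ha0 hab hr).const_mul (M * σ ^ (1 - a - t + c))
  have hdiale : ∀ᵐ ξ : ℝ ∂(volume.restrict (Ioi (0 : ℝ))),
      ‖f ξ ξ‖ ≤ M * σ ^ (1 - a - t + c) * (ξ ^ (a - 1) * (r + ξ) ^ b) := by
    filter_upwards [ae_restrict_mem measurableSet_Ioi] with ξ hξ
    refine (hfM ξ ξ hξ hξ).trans ?_
    rw [mul_assoc]
    exact mul_le_mul_of_nonneg_left (diag_majorant_le h1 h2 hr hσ hξ) hM
  refine ⟨⟨hoff.mono' (hW.aestronglyMeasurable_kerTilde.mul (hf.aestronglyMeasurable hm)) hoffle,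
    hdia.mono' ((continuousOn_diag hf).aestronglyMeasurable measurableSet_Ioi) hdiale⟩, ?_⟩
  have e1 := norm_integral_le_of_norm_le hoff hoffle
  have e2 := norm_integral_le_of_norm_le hdia hdiale
  rw [integral_const_mul, Measure.volume_eq_prod, setIntegral_prod_mul
    (fun x : ℝ => x ^ (a - 1) * (r + x) ^ b) (fun y : ℝ => y ^ (1 - a - t - 1) * (σ + y) ^ c),
    integral_rpow_mul_add_rpow hr, integral_rpow_mul_add_rpow hσ, ← hI₁, ← hI₂,
    ← Measure.volume_eq_prod, Real.norm_eq_abs] at e1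
  rw [integral_const_mul, integral_rpow_mul_add_rpow hr, ← hI₁, Real.norm_eq_abs] at e2
  rw [kerIntegral]
  refine (abs_add_le _ _).trans ?_
  rw [abs_mul]
  have e3 := mul_le_mul_of_nonneg_left e2 (abs_nonneg (diagCoeff V))
  refine (add_le_add e1 e3).trans (le_of_eq ?_)
  ring

/-- Continuous dependence on a parameter of integrals against the representation kernel. -/
lemma Admissible.continuousAt_kerIntegral (hα : α ∈ Ioo (0 : ℝ) 1) (hW : Admissible α W V)
    {a b c t : ℝ} (ha : a ∈ Icc α (1 - α)) (hab : a + b < 0)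
    (h1 : 0 < 1 - a - t) (h2 : 1 - a - t + c < 0) {r σ M r₀ : ℝ} (hr : 0 < r) (hσ : 0 < σ)
    {f : ℝ → ℝ → ℝ → ℝ}
    (hf : ∀ᶠ x in 𝓝 r₀, ContinuousOn (fun z : ℝ × ℝ => f x z.1 z.2) (Ioi 0 ×ˢ Ioi 0))
    (hfM : ∀ᶠ x in 𝓝 r₀, ∀ ξ η : ℝ, 0 < ξ → 0 < η →
        |f x ξ η| ≤ M * ((r + ξ) ^ b * (η ^ (-t) * (σ + η) ^ c)))
    (hfc : ∀ ξ η : ℝ, 0 < ξ → 0 < η → ContinuousAt (fun x => f x ξ η) r₀) :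
    ContinuousAt (fun x => kerIntegral V (f x)) r₀ := by
  obtain ⟨C, hC0, hC⟩ := hW.exists_abs_kerTilde_le hα
  have ha0 : 0 < a := hα.1.trans_le ha.1
  have hM : 0 ≤ M := by
    have := (abs_nonneg _).trans (hfM.self_of_nhds 1 1 one_pos one_pos)
    exact nonneg_of_mul_nonneg_left this (by positivity)
  have hm : MeasurableSet (Ioi (0 : ℝ) ×ˢ Ioi (0 : ℝ)) := measurableSet_Ioi.prod measurableSet_Ioi
  refine ContinuousAt.add ?_ (ContinuousAt.mul continuousAt_const ?_)
  · refine continuousAt_of_dominated ?_ ?_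
      ((integrableOn_offdiag_majorant ha0 hab h1 h2 hr hσ).const_mul (C * M)) ?_
    · filter_upwards [hf] with x hx
      exact hW.aestronglyMeasurable_kerTilde.mul (hx.aestronglyMeasurable hm)
    · filter_upwards [hfM] with x hx
      filter_upwards [ae_restrict_mem hm] with z hz
      exact offdiag_majorant_le hC0 hz.1 hz.2 (hC a ha _ _ hz.1 hz.2) (hx _ _ hz.1 hz.2)
    · filter_upwards [ae_restrict_mem hm] with z hz
      exact continuousAt_const.mul (hfc _ _ hz.1 hz.2)
  · refine continuousAt_of_dominated ?_ ?_
      ((integrableOn_rpow_mul_add_rpow ha0 hab hr).const_mul (M * σ ^ (1 - a - t + c))) ?_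
    · filter_upwards [hf] with x hx
      exact (continuousOn_diag hx).aestronglyMeasurable measurableSet_Ioi
    · filter_upwards [hfM] with x hx
      filter_upwards [ae_restrict_mem measurableSet_Ioi] with ξ hξ
      refine (hx ξ ξ hξ hξ).trans ?_
      rw [mul_assoc]
      exact mul_le_mul_of_nonneg_left (diag_majorant_le h1 h2 hr hσ hξ) hM
    · filter_upwards [ae_restrict_mem measurableSet_Ioi] with ξ hξ
      exact hfc _ _ hξ hξ

lemma KerIntegrable.sub {f g : ℝ → ℝ → ℝ} (hf : KerIntegrable V f) (hg : KerIntegrable V g) :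
    KerIntegrable V (fun ξ η => f ξ η - g ξ η) ∧
      kerIntegral V (fun ξ η => f ξ η - g ξ η) = kerIntegral V f - kerIntegral V g := by
  refine ⟨⟨?_, hf.2.sub hg.2⟩, ?_⟩
  · simp only [mul_sub]
    exact hf.1.sub hg.1
  · simp only [kerIntegral, mul_sub]
    rw [integral_sub hf.1 hg.1, integral_sub hf.2 hg.2]
    ring

/-! ### Functions in the weighted spaces -/

/-- `G` is twice continuously differentiable on `(0,∞)` and its norm in `X²_{0,θ}` is at most
`A`. -/
structure Controlled (ρ θ A : ℝ) (G : ℝ → ℝ) : Prop where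
  nonneg : 0 ≤ A
  hasDerivAt : ∀ q : ℝ, 0 < q → HasDerivAt G (deriv G q) q
  hasDerivAt_deriv : ∀ q : ℝ, 0 < q → HasDerivAt (deriv G) (iteratedDeriv 2 G q) q
  continuousOn_iteratedDeriv : ContinuousOn (iteratedDeriv 2 G) (Ioi 0)
  abs_le : ∀ q : ℝ, 0 < q → |G q| ≤ A * (1 + q) ^ (-θ)
  abs_deriv_le : ∀ q : ℝ, 0 < q → |deriv G q| ≤ A * (q ^ (ρ - 1) * (1 + q) ^ (-(ρ + θ)))
  abs_iteratedDeriv_le : ∀ q : ℝ, 0 < q →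
    |iteratedDeriv 2 G q| ≤ A * (q ^ (ρ - 2) * (1 + q) ^ (-(ρ + θ)))

lemma le_toReal_seminormX {ρ μ χ : ℝ} {k : ℕ} {G : ℝ → ℝ} (h : seminormX ρ k μ χ G ≠ ∞) {q : ℝ}
    (hq : 0 < q) :
    |iteratedDeriv k G q| ≤
      (seminormX ρ k μ χ G).toReal * (q ^ (ρ + μ - k) * (1 + q) ^ (-(χ + μ + ρ))) := by
  have h1 : ENNReal.ofReal ((1 + q) ^ (χ + μ + ρ) * q ^ ((k : ℝ) - ρ - μ) *
      |iteratedDeriv k G q|) ≤ seminormX ρ k μ χ G :=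
    le_iSup₂ (f := fun q (_ : q ∈ Ioi (0 : ℝ)) => ENNReal.ofReal ((1 + q) ^ (χ + μ + ρ) *
      q ^ ((k : ℝ) - ρ - μ) * |iteratedDeriv k G q|)) q hq
  have h2 := (ENNReal.ofReal_le_iff_le_toReal h).1 h1
  have hp : 0 < q ^ (ρ + μ - k) * (1 + q) ^ (-(χ + μ + ρ)) := by positivity
  have e : (q ^ (ρ + μ - k) * (1 + q) ^ (-(χ + μ + ρ))) *
      ((1 + q) ^ (χ + μ + ρ) * q ^ ((k : ℝ) - ρ - μ)) = 1 := by
    have e1 : q ^ (ρ + μ - k) * q ^ ((k : ℝ) - ρ - μ) = 1 := by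
      rw [← Real.rpow_add hq, show ρ + μ - k + ((k : ℝ) - ρ - μ) = 0 by ring, Real.rpow_zero]
    have e2 : (1 + q) ^ (-(χ + μ + ρ)) * (1 + q) ^ (χ + μ + ρ) = 1 := by
      rw [← Real.rpow_add (by positivity), neg_add_cancel, Real.rpow_zero]
    linear_combination (1 + q) ^ (-(χ + μ + ρ)) * (1 + q) ^ (χ + μ + ρ) * e1 + e2
  calc |iteratedDeriv k G q| = (q ^ (ρ + μ - k) * (1 + q) ^ (-(χ + μ + ρ))) *
      ((1 + q) ^ (χ + μ + ρ) * q ^ ((k : ℝ) - ρ - μ) * |iteratedDeriv k G q|) := by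
        rw [← mul_assoc, e, one_mul]
    _ ≤ (q ^ (ρ + μ - k) * (1 + q) ^ (-(χ + μ + ρ))) * (seminormX ρ k μ χ G).toReal := by gcongr
    _ = _ := mul_comm _ _

lemma controlled_of_mem_X {ρ θ : ℝ} {G : ℝ → ℝ} (hG : G ∈ X ρ 2 0 θ) :
    Controlled ρ θ (normX ρ 2 0 θ G).toReal G := by
  obtain ⟨hd, -, hn⟩ := hG
  have hd1 : ContDiffOn ℝ 1 (deriv G) (Ioi 0) :=
    hd.deriv_of_isOpen isOpen_Ioi (by norm_num)
  have hd2 : ContDiffOn ℝ 0 (deriv (deriv G)) (Ioi 0) :=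
    hd1.deriv_of_isOpen isOpen_Ioi (by norm_num)
  have hi : iteratedDeriv 2 G = deriv (deriv G) := by
    rw [iteratedDeriv_succ, iteratedDeriv_one]
  have hle : ∀ (k : ℕ) (ν : ℝ), seminormX ρ k ν θ G ≤ normX ρ 2 0 θ G → ∀ q : ℝ, 0 < q →
      |iteratedDeriv k G q| ≤
        (normX ρ 2 0 θ G).toReal * (q ^ (ρ + ν - k) * (1 + q) ^ (-(θ + ν + ρ))) := by
    intro k ν h q hq
    refine (le_toReal_seminormX (h.trans_lt hn).ne hq).trans ?_
    gcongr
    exact hn.ne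
  have hs : ∀ l ∈ Finset.Icc 1 2, seminormX ρ l 0 θ G ≤ normX ρ 2 0 θ G := fun l hl =>
    (Finset.single_le_sum (f := fun l => seminormX ρ l 0 θ G) (fun _ _ => zero_le) hl).trans
      le_add_self
  refine ⟨ENNReal.toReal_nonneg, fun q hq => ?_, fun q hq => ?_, ?_, fun q hq => ?_,
    fun q hq => ?_, fun q hq => ?_⟩
  · exact ((hd.differentiableOn (by norm_num)).differentiableAt (Ioi_mem_nhds hq)).hasDerivAt
  · rw [hi]
    exact ((hd1.differentiableOn (by norm_num)).differentiableAt (Ioi_mem_nhds hq)).hasDerivAt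
  · rw [hi]; exact hd2.continuousOn
  -- With `ν = -ρ` the weight of order zero has no power of `q`, only `(1+q)^(-θ)`.
  · have := hle 0 (-ρ) le_self_add q hq
    simpa using this
  · have := hle 1 0 (hs 1 (by simp)) q hq
    rw [iteratedDeriv_one] at this
    refine this.trans (le_of_eq ?_)
    norm_num [add_comm]
  · have := hle 2 0 (hs 2 (by simp)) q hq
    refine this.trans (le_of_eq ?_)
    norm_num [add_comm]

/-- The weight behaves like `x^(ρ-1)` at `0` and like `x^(-1-θ)` at infinity, so any pure power with
exponent in between dominates it. The free exponent `b` is what the later estimates tune. -/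
lemma rpow_mul_one_add_rpow_le {ρ θ b x : ℝ} (hρθ : 0 ≤ ρ + θ) (hx : 0 < x)
    (hb : -1 - θ ≤ b) (hb' : b ≤ ρ - 1) : x ^ (ρ - 1) * (1 + x) ^ (-(ρ + θ)) ≤ x ^ b := by
  rcases le_total x 1 with h | h
  · calc x ^ (ρ - 1) * (1 + x) ^ (-(ρ + θ)) ≤ x ^ b * 1 := by
          gcongr ?_ * ?_
          · exact Real.rpow_le_rpow_of_exponent_ge hx h hb'
          · exact Real.rpow_le_one_of_one_le_of_nonpos (by linarith) (by linarith)
      _ = x ^ b := mul_one _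
  · calc x ^ (ρ - 1) * (1 + x) ^ (-(ρ + θ)) ≤ x ^ (ρ - 1) * x ^ (-(ρ + θ)) := by
          gcongr ?_ * ?_
          exact Real.rpow_le_rpow_of_nonpos hx (by linarith) (by linarith)
      _ = x ^ (-1 - θ) := by rw [← Real.rpow_add hx]; congr 1; ring
      _ ≤ x ^ b := Real.rpow_le_rpow_of_exponent_le h hb

/-- Increments of a function whose derivative is bounded by a decreasing power. -/
lemma abs_sub_le_of_abs_deriv_le_rpow {f f' : ℝ → ℝ} {A b x h : ℝ} (hA : 0 ≤ A)
    (hf : ∀ y : ℝ, 0 < y → HasDerivAt f (f' y) y) (hf' : ∀ y : ℝ, 0 < y → |f' y| ≤ A * y ^ b)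
    (hb : b ≤ 0) (hx : 0 < x) (hh : 0 ≤ h) : |f x - f (x + h)| ≤ A * h * x ^ b := by
  have := (convex_Icc x (x + h)).norm_image_sub_le_of_norm_hasDerivWithin_le (f := f) (f' := f')
    (C := A * x ^ b)
    (fun y hy => (hf y (hx.trans_le hy.1)).hasDerivWithinAt) (fun y hy => ?_)
    (left_mem_Icc.2 (by linarith)) (right_mem_Icc.2 (by linarith))
  · rw [Real.norm_eq_abs, Real.norm_eq_abs, add_sub_cancel_left, abs_of_nonneg hh, abs_sub_comm]
      at this
    linarith
  · refine (hf' y (hx.trans_le hy.1)).trans ?_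
    gcongr ?_ * ?_
    exact Real.rpow_le_rpow_of_nonpos hx hy.1 hb

/-! ### Pure-power bounds and increments of controlled functions. -/

namespace Controlled

variable {ρ θ A : ℝ} {G : ℝ → ℝ}

lemma abs_deriv_le_rpow (hG : Controlled ρ θ A G) (hρθ : 0 ≤ ρ + θ) {b x : ℝ}
    (hb : b ∈ Icc (-1 - θ) (ρ - 1)) (hx : 0 < x) : |deriv G x| ≤ A * x ^ b :=
  (hG.abs_deriv_le x hx).trans
    (mul_le_mul_of_nonneg_left (rpow_mul_one_add_rpow_le hρθ hx hb.1 hb.2) hG.nonneg)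

lemma abs_iteratedDeriv_le_rpow (hG : Controlled ρ θ A G) (hρθ : 0 ≤ ρ + θ) {b x : ℝ}
    (hb : b ∈ Icc (-1 - θ) (ρ - 1)) (hx : 0 < x) : |iteratedDeriv 2 G x| ≤ A * x ^ (b - 1) := by
  refine (hG.abs_iteratedDeriv_le x hx).trans (mul_le_mul_of_nonneg_left ?_ hG.nonneg)
  rw [show ρ - 2 = ρ - 1 - 1 by ring, Real.rpow_sub_one hx.ne', Real.rpow_sub_one hx.ne' b,
    div_mul_eq_mul_div]
  gcongr
  exact rpow_mul_one_add_rpow_le hρθ hx hb.1 hb.2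

lemma abs_le_rpow (hG : Controlled ρ θ A G) (hθ : 0 ≤ θ) {x : ℝ} (hx : 0 < x) :
    |G x| ≤ A * x ^ (-θ) :=
  (hG.abs_le x hx).trans (mul_le_mul_of_nonneg_left
    (Real.rpow_le_rpow_of_nonpos hx (by linarith) (by linarith)) hG.nonneg)

lemma continuousOn (hG : Controlled ρ θ A G) : ContinuousOn G (Ioi 0) :=
  fun q hq => (hG.hasDerivAt q hq).continuousAt.continuousWithinAt

lemma continuousOn_deriv (hG : Controlled ρ θ A G) : ContinuousOn (deriv G) (Ioi 0) :=
  fun q hq => (hG.hasDerivAt_deriv q hq).continuousAt.continuousWithinAt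

/-- Increments of `G`, small scales. -/
lemma abs_sub_le_of_holder (hG : Controlled ρ θ A G) (hρθ : 0 ≤ ρ + θ) (hθ : 0 ≤ θ) {κ r η : ℝ}
    (hκ : κ ∈ Ioc 0 ρ) (hκ1 : κ ≤ 1) (hr : 0 < r) (hη : 0 < η) :
    |G η - G (η + r)| ≤ A / κ * (r * (r + η) ^ (κ - 1)) := by
  obtain ⟨hκ0, hκρ⟩ := hκ
  have hd : ∀ x ∈ Icc η (η + r), HasDerivAt (fun x => A / κ * (x ^ κ - η ^ κ))
      (A * x ^ (κ - 1)) x := by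
    intro x hx
    have hx0 : 0 < x := hη.trans_le hx.1
    have h := ((Real.hasDerivAt_rpow_const (p := κ) (Or.inl hx0.ne')).sub_const
      (η ^ κ)).const_mul (A / κ)
    rwa [← mul_assoc, div_mul_cancel₀ _ hκ0.ne'] at h
  -- Comparison with the primitive of `A x^(κ-1)`, which stays finite at `0` because `κ > 0`.
  have h1 := image_norm_le_of_norm_deriv_right_le_deriv_boundary' (a := η) (b := η + r)
    (f := fun x => G x - G η) (f' := deriv G) (B := fun x => A / κ * (x ^ κ - η ^ κ))
    (B' := fun x => A * x ^ (κ - 1))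
    (fun x hx => ((hG.hasDerivAt x (hη.trans_le hx.1)).sub_const _).continuousAt.continuousWithinAt)
    (fun x hx => ((hG.hasDerivAt x (hη.trans_le hx.1)).sub_const _).hasDerivWithinAt)
    (by simp) (fun x hx => (hd x hx).continuousAt.continuousWithinAt)
    (fun x hx => (hd x (Ico_subset_Icc_self hx)).hasDerivWithinAt)
    (fun x hx => hG.abs_deriv_le_rpow hρθ (b := κ - 1) ⟨by linarith, by linarith⟩
      (hη.trans_le hx.1)) (right_mem_Icc.2 (by linarith))
  rw [Real.norm_eq_abs, abs_sub_comm] at h1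
  refine h1.trans (mul_le_mul_of_nonneg_left ?_ (div_nonneg hG.nonneg hκ0.le))
  -- Since `κ ≤ 1`, this gives `(η+r)^κ - η^κ ≤ r (η+r)^(κ-1)`.
  have h2 : (η + r) ^ (κ - 1) ≤ η ^ (κ - 1) :=
    Real.rpow_le_rpow_of_nonpos hη (by linarith) (by linarith)
  have e1 : η ^ κ = η ^ (κ - 1) * η := by rw [← Real.rpow_add_one hη.ne']; ring_nf
  have e2 : (η + r) ^ κ = (η + r) ^ (κ - 1) * (η + r) := by
    rw [← Real.rpow_add_one (by positivity)]; ring_nf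
  rw [e1, e2, add_comm r η]
  nlinarith

/-- Increments of `G`, large scales. -/
lemma abs_sub_le_of_decay (hG : Controlled ρ θ A G) (hρθ : 0 ≤ ρ + θ) (hθ : 0 ≤ θ) {r η : ℝ}
    (hr : 0 < r) (hη : 0 < η) :
    |G η - G (η + r)| ≤ 4 * A * (r * (η ^ (-θ) * (r + η) ^ (-1 : ℝ))) := by
  have hA := hG.nonneg
  have hp : 0 < η ^ (-θ) := Real.rpow_pos_of_pos hη _
  have hs : 0 < r + η := by positivity
  rw [Real.rpow_neg_one, ← div_eq_mul_inv, mul_div_assoc', mul_div_assoc', le_div_iff₀ hs]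
  -- For `η ≤ r` the two values are bounded separately, and `r + η ≤ 2r`. For `η ≥ r` the mean value
  -- inequality supplies the factor `r/η`, and `r + η ≤ 2η`.
  rcases le_total η r with h | h
  · have h1 : (η + r) ^ (-θ) ≤ η ^ (-θ) :=
      Real.rpow_le_rpow_of_nonpos hη (by linarith) (by linarith)
    have h2 : |G η - G (η + r)| ≤ 2 * A * η ^ (-θ) := by
      have e1 := hG.abs_le_rpow hθ hη
      have e2 := hG.abs_le_rpow hθ (x := η + r) (by positivity)
      have e3 := abs_sub (G η) (G (η + r))
      have e4 : A * (η + r) ^ (-θ) ≤ A * η ^ (-θ) := by gcongr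
      linarith
    calc |G η - G (η + r)| * (r + η) ≤ 2 * A * η ^ (-θ) * (r + r) := by gcongr
      _ = _ := by ring
  · have h2 := abs_sub_le_of_abs_deriv_le_rpow hA hG.hasDerivAt
      (fun y hy => hG.abs_deriv_le_rpow hρθ (b := -1 - θ) ⟨le_rfl, by linarith⟩ hy)
      (by linarith) hη hr.le
    rw [show -1 - θ = -θ - 1 by ring, Real.rpow_sub_one hη.ne'] at h2
    calc |G η - G (η + r)| * (r + η) ≤ A * r * (η ^ (-θ) / η) * (η + η) := by gcongr
      _ = 2 * (A * r * η ^ (-θ)) := by field_simp; ring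
      _ ≤ 4 * (A * r * η ^ (-θ)) := by
        have : 0 ≤ A * r * η ^ (-θ) := by positivity
        linarith
      _ = _ := by ring

end Controlled

/-! ### Bounds on `N[G,H]` -/

/-- The part of `integrand₂` in which only `G` is shifted. -/
def derivProd (G H : ℝ → ℝ) (r ξ η : ℝ) : ℝ := deriv G (r + ξ) * deriv H η

/-- The part of `integrand₂` in which both functions are shifted. -/
def derivProdShift (G H : ℝ → ℝ) (r ξ η : ℝ) : ℝ := deriv G (r + ξ) * deriv H (η + r)

/-- The two halves are integrable separately, so no cancellation in `H'(η) - H'(η+r)` is needed.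
They are kept apart because they decay at different rates in `r`. -/
lemma integrand₂_eq (G H : ℝ → ℝ) (r : ℝ) :
    integrand₂ G H r = fun ξ η => derivProd G H r ξ η - derivProdShift G H r ξ η := by
  funext ξ η
  simp only [integrand₂, derivProd, derivProdShift, mul_sub]

lemma add_rpow_le_add_rpow {r₁ r x b : ℝ} (hr₁ : 0 < r₁) (hr : r₁ ≤ r) (hx : 0 ≤ x)
    (hb : b ≤ 0) : (r + x) ^ b ≤ (r₁ + x) ^ b :=
  Real.rpow_le_rpow_of_nonpos (by linarith) (by linarith) hb

/-! ### Product majorants for the three integrands. -/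

section Pointwise

variable {ρ θ A B : ℝ} {G H : ℝ → ℝ} {r r₁ ξ η : ℝ}

/-- The majorant is taken at some `r₁ ≤ r` so that it is uniform for `r` near a given point. Size
estimates use `r₁ = r`; continuity in `r` uses half the base point. -/
lemma abs_integrand₁_le_of_holder (hG : Controlled ρ θ A G) (hH : Controlled ρ θ B H)
    (hθ : 0 ≤ θ) {κ : ℝ} (hκ : κ ∈ Ioc 0 ρ) (hκ1 : κ ≤ 1) (hr₁ : 0 < r₁) (hr : r₁ ≤ r)
    (hξ : 0 < ξ) (hη : 0 < η) :
    |integrand₁ G H r ξ η| ≤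
      A * B / κ * r * ((r₁ + ξ) ^ (κ - 2) * (η ^ (-(0 : ℝ)) * (r₁ + η) ^ (κ - 1))) := by
  have hρθ : 0 ≤ ρ + θ := by linarith [hκ.1, hκ.2]
  have hr0 : 0 < r := hr₁.trans_le hr
  have hA := hG.nonneg
  have hB := hH.nonneg
  have hκ0 := hκ.1
  have h1 := hG.abs_iteratedDeriv_le_rpow hρθ (b := κ - 1) (x := r + ξ)
    ⟨by linarith, by linarith [hκ.2]⟩ (by positivity)
  rw [show κ - 1 - 1 = κ - 2 by ring] at h1
  have h2 := hH.abs_sub_le_of_holder hρθ hθ hκ hκ1 hr0 hη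
  have h3 := add_rpow_le_add_rpow hr₁ hr hξ.le (b := κ - 2) (by linarith)
  have h4 := add_rpow_le_add_rpow hr₁ hr hη.le (b := κ - 1) (by linarith)
  rw [integrand₁, abs_mul, neg_zero, Real.rpow_zero, one_mul]
  calc _ ≤ A * (r + ξ) ^ (κ - 2) * (B / κ * (r * (r + η) ^ (κ - 1))) := by gcongr
    _ ≤ A * (r₁ + ξ) ^ (κ - 2) * (B / κ * (r * (r₁ + η) ^ (κ - 1))) := by gcongr
    _ = _ := by ring

lemma abs_integrand₁_le_of_decay (hG : Controlled ρ θ A G) (hH : Controlled ρ θ B H)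
    (hρ : 0 ≤ ρ) (hθ : 0 ≤ θ) (hr : 0 < r) (hξ : 0 < ξ) (hη : 0 < η) :
    |integrand₁ G H r ξ η| ≤
      4 * (A * B) * r * ((r + ξ) ^ (-2 - θ) * (η ^ (-θ) * (r + η) ^ (-1 : ℝ))) := by
  have hρθ : 0 ≤ ρ + θ := by linarith
  have hA := hG.nonneg
  have hB := hH.nonneg
  have h1 := hG.abs_iteratedDeriv_le_rpow hρθ (b := -1 - θ) (x := r + ξ)
    ⟨le_rfl, by linarith⟩ (by positivity)
  rw [show -1 - θ - 1 = -2 - θ by ring] at h1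
  have h2 := hH.abs_sub_le_of_decay hρθ hθ hr hη
  rw [integrand₁, abs_mul]
  calc _ ≤ A * (r + ξ) ^ (-2 - θ) * (4 * B * (r * (η ^ (-θ) * (r + η) ^ (-1 : ℝ)))) := by gcongr
    _ = _ := by ring

lemma abs_derivProdShift_le (hG : Controlled ρ θ A G) (hH : Controlled ρ θ B H)
    (hρθ : 0 ≤ ρ + θ) {b : ℝ} (hb : b ∈ Icc (-1 - θ) (ρ - 1)) (hb0 : b ≤ 0)
    (hr₁ : 0 < r₁) (hr : r₁ ≤ r) (hξ : 0 < ξ) (hη : 0 < η) :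
    |derivProdShift G H r ξ η| ≤
      A * B * ((r₁ + ξ) ^ b * (η ^ (-(0 : ℝ)) * (r₁ + η) ^ b)) := by
  have hr0 : 0 < r := hr₁.trans_le hr
  have hA := hG.nonneg
  have hB := hH.nonneg
  have h1 := hG.abs_deriv_le_rpow hρθ hb (x := r + ξ) (by positivity)
  have h2 := hH.abs_deriv_le_rpow hρθ hb (x := η + r) (by positivity)
  rw [add_comm η r] at h2
  have h3 := add_rpow_le_add_rpow hr₁ hr hξ.le hb0
  have h4 := add_rpow_le_add_rpow hr₁ hr hη.le hb0
  rw [derivProdShift, abs_mul, neg_zero, Real.rpow_zero, one_mul, add_comm η r]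
  calc _ ≤ A * (r + ξ) ^ b * (B * (r + η) ^ b) := by gcongr
    _ ≤ A * (r₁ + ξ) ^ b * (B * (r₁ + η) ^ b) := by gcongr
    _ = _ := by ring

lemma abs_derivProd_le (hG : Controlled ρ θ A G) (hH : Controlled ρ θ B H)
    (hρθ : 0 ≤ ρ + θ) {b : ℝ} (hb : b ∈ Icc (-1 - θ) (ρ - 1)) (hb0 : b ≤ 0)
    (hr₁ : 0 < r₁) (hr : r₁ ≤ r) (hξ : 0 < ξ) (hη : 0 < η) :
    |derivProd G H r ξ η| ≤
      A * B * ((r₁ + ξ) ^ b * (η ^ (-(1 - ρ)) * (1 + η) ^ (-(ρ + θ)))) := by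
  have hr0 : 0 < r := hr₁.trans_le hr
  have hA := hG.nonneg
  have hB := hH.nonneg
  have h1 := hG.abs_deriv_le_rpow hρθ hb (x := r + ξ) (by positivity)
  have h2 := hH.abs_deriv_le η hη
  have h3 := add_rpow_le_add_rpow hr₁ hr hξ.le hb0
  rw [derivProd, abs_mul, neg_sub]
  calc _ ≤ A * (r + ξ) ^ b * (B * (η ^ (ρ - 1) * (1 + η) ^ (-(ρ + θ)))) := by gcongr
    _ ≤ A * (r₁ + ξ) ^ b * (B * (η ^ (ρ - 1) * (1 + η) ^ (-(ρ + θ)))) := by gcongr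
    _ = _ := by ring

lemma abs_derivProd_sub_le (hG : Controlled ρ θ A G) (hH : Controlled ρ θ B H)
    (hρ : 0 ≤ ρ) (hθ : 0 ≤ θ) (hr : 0 < r) (hξ : 0 < ξ) (hη : 0 < η) :
    |derivProd G H r ξ η - derivProd G H (r + 1) ξ η| ≤
      A * B * ((r + ξ) ^ (-2 - θ) * (η ^ (-(1 - ρ)) * (1 + η) ^ (-(ρ + θ)))) := by
  have hA := hG.nonneg
  have hB := hH.nonneg
  have h1 := abs_sub_le_of_abs_deriv_le_rpow (h := 1) hA hG.hasDerivAt_deriv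
    (fun y hy => hG.abs_iteratedDeriv_le_rpow (by linarith) (b := -1 - θ)
      ⟨le_rfl, by linarith⟩ hy) (by linarith) (show 0 < r + ξ by positivity) zero_le_one
  rw [show -1 - θ - 1 = -2 - θ by ring, mul_one] at h1
  have h2 := hH.abs_deriv_le η hη
  rw [derivProd, derivProd, ← sub_mul, abs_mul, neg_sub, show r + 1 + ξ = r + ξ + 1 by ring]
  calc _ ≤ A * (r + ξ) ^ (-2 - θ) * (B * (η ^ (ρ - 1) * (1 + η) ^ (-(ρ + θ)))) := by gcongr
    _ = _ := by ring

end Pointwise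

/-! ### Continuity of the integrands in the integration variables and in `r`. -/

section Continuity

variable {ρ θ A B : ℝ} {G H : ℝ → ℝ} {r : ℝ}

lemma continuousOn_shift {f : ℝ → ℝ} (hf : ContinuousOn f (Ioi 0)) (hr : 0 ≤ r)
    {g : ℝ × ℝ → ℝ} (hg : Continuous g) (hg0 : ∀ z ∈ Ioi (0 : ℝ) ×ˢ Ioi (0 : ℝ), 0 < g z) :
    ContinuousOn (fun z : ℝ × ℝ => f (r + g z)) (Ioi 0 ×ˢ Ioi 0) :=
  hf.comp (f := fun z => r + g z) (by fun_prop) fun z hz => by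
    have := hg0 z hz
    exact mem_Ioi.2 (by positivity)

lemma continuousOn_integrand₁ (hG : Controlled ρ θ A G) (hH : Controlled ρ θ B H) (hr : 0 ≤ r) :
    ContinuousOn (fun z : ℝ × ℝ => integrand₁ G H r z.1 z.2) (Ioi 0 ×ˢ Ioi 0) := by
  have h1 := continuousOn_shift hG.continuousOn_iteratedDeriv hr continuous_fst fun z hz => hz.1
  have h2 := continuousOn_shift hH.continuousOn le_rfl continuous_snd fun z hz => hz.2
  have h3 := continuousOn_shift hH.continuousOn hr continuous_snd fun z hz => hz.2
  refine (h1.mul (h2.sub h3)).congr fun z _ => ?_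
  simp [integrand₁, add_comm]

lemma continuousOn_derivProd (hG : Controlled ρ θ A G) (hH : Controlled ρ θ B H) (hr : 0 ≤ r) :
    ContinuousOn (fun z : ℝ × ℝ => derivProd G H r z.1 z.2) (Ioi 0 ×ˢ Ioi 0) := by
  have h1 := continuousOn_shift hG.continuousOn_deriv hr continuous_fst fun z hz => hz.1
  have h2 := continuousOn_shift hH.continuousOn_deriv le_rfl continuous_snd fun z hz => hz.2
  refine (h1.mul h2).congr fun z _ => ?_
  simp [derivProd]

lemma continuousOn_derivProdShift (hG : Controlled ρ θ A G) (hH : Controlled ρ θ B H)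
    (hr : 0 ≤ r) :
    ContinuousOn (fun z : ℝ × ℝ => derivProdShift G H r z.1 z.2) (Ioi 0 ×ˢ Ioi 0) := by
  have h1 := continuousOn_shift hG.continuousOn_deriv hr continuous_fst fun z hz => hz.1
  have h2 := continuousOn_shift hH.continuousOn_deriv hr continuous_snd fun z hz => hz.2
  refine (h1.mul h2).congr fun z _ => ?_
  simp [derivProdShift, add_comm]

lemma continuousAt_shift {f : ℝ → ℝ} (hf : ContinuousOn f (Ioi 0)) {x : ℝ} (hx : 0 < x)
    (hr : 0 < r) : ContinuousAt (fun s => f (s + x)) r :=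
  ContinuousAt.comp (f := fun s => s + x)
    (hf.continuousAt (Ioi_mem_nhds (add_pos hr hx))) (by fun_prop)

end Continuity

/-! ### Power bounds for `N[G,H]` and for its unit increments. -/

section KernelBounds

variable {ρ θ : ℝ}

lemma half_mem_Icc (hθ : θ ∈ Ioo α (min ρ (1 / 2))) : (1 / 2 : ℝ) ∈ Icc α (1 - α) := by
  have h := hθ.2.trans_le (min_le_right _ _)
  constructor <;> linarith [hθ.1]

/-- Kernel exponent `a = 1/2`; the condition `κ < 1/2` makes the `η`-integral converge at infinity.
The powers of `r` are `κ - 3/2` from `ξ`, `κ - 1/2` from `η` and `1` from the increment of `H`. -/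
lemma Admissible.exists_integrand₁_le_of_holder (hα : α ∈ Ioo (0 : ℝ) 1)
    (hW : Admissible α W V) (hθ : θ ∈ Ioo α (min ρ (1 / 2))) {κ : ℝ}
    (hκ : κ ∈ Ioc 0 ρ) (hκ1 : κ < 1 / 2) :
    ∃ C : ℝ, 0 ≤ C ∧ ∀ (A B : ℝ) (G H : ℝ → ℝ), Controlled ρ θ A G → Controlled ρ θ B H →
      ∀ r : ℝ, 0 < r → KerIntegrable V (integrand₁ G H r) ∧
        |kerIntegral V (integrand₁ G H r)| ≤ C * (A * B) * r ^ (2 * κ - 1) := by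
  obtain ⟨C, hC0, hC⟩ := hW.exists_kerIntegral_le hα (half_mem_Icc hθ) (b := κ - 2)
    (c := κ - 1) (t := 0) (by linarith) (by norm_num) (by linarith)
  have hκ0 := hκ.1
  refine ⟨C / κ, by positivity, fun A B G H hG hH r hr => ?_⟩
  obtain ⟨h1, h2⟩ := hC r r _ hr hr _ (continuousOn_integrand₁ hG hH hr.le) fun ξ η hξ hη =>
    abs_integrand₁_le_of_holder hG hH (hα.1.trans hθ.1).le hκ (by linarith) hr le_rfl hξ hη
  refine ⟨h1, h2.trans (le_of_eq ?_)⟩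
  have e : r ^ (2 * κ - 1) = r * (r ^ (1 / 2 + (κ - 2)) * r ^ (1 - 1 / 2 - 0 + (κ - 1))) := by
    rw [← Real.rpow_add hr, mul_comm r, ← Real.rpow_add_one hr.ne']; congr 1; ring
  rw [e]; ring

lemma Admissible.exists_integrand₁_le_of_decay (hα : α ∈ Ioo (0 : ℝ) 1) (hρ : ρ ∈ Ioo (0 : ℝ) 1)
    (hW : Admissible α W V) (hθ : θ ∈ Ioo α (min ρ (1 / 2))) :
    ∃ C : ℝ, 0 ≤ C ∧ ∀ (A B : ℝ) (G H : ℝ → ℝ), Controlled ρ θ A G → Controlled ρ θ B H →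
      ∀ r : ℝ, 0 < r → |kerIntegral V (integrand₁ G H r)| ≤ C * (A * B) * r ^ (-1 - 2 * θ) := by
  have hθ0 : 0 < θ := hα.1.trans hθ.1
  have hθ2 : θ < 1 / 2 := hθ.2.trans_le (min_le_right _ _)
  obtain ⟨C, hC0, hC⟩ := hW.exists_kerIntegral_le hα (half_mem_Icc hθ) (b := -2 - θ)
    (c := -1) (t := θ) (by linarith) (by linarith) (by linarith)
  refine ⟨C * 4, by positivity, fun A B G H hG hH r hr => ?_⟩
  obtain ⟨h1, h2⟩ := hC r r _ hr hr _ (continuousOn_integrand₁ hG hH hr.le) fun ξ η hξ hη =>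
    abs_integrand₁_le_of_decay hG hH hρ.1.le hθ0.le hr hξ hη
  refine h2.trans (le_of_eq ?_)
  have e : r ^ (-1 - 2 * θ) = r * (r ^ (1 / 2 + (-2 - θ)) * r ^ (1 - 1 / 2 - θ + -1)) := by
    rw [← Real.rpow_add hr, mul_comm r, ← Real.rpow_add_one hr.ne']; congr 1; ring
  rw [e]; ring

lemma Admissible.exists_derivProdShift_le (hα : α ∈ Ioo (0 : ℝ) 1) (hρ : ρ ∈ Ioo (0 : ℝ) 1)
    (hW : Admissible α W V) (hθ : θ ∈ Ioo α (min ρ (1 / 2))) {b : ℝ}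
    (hb : b ∈ Icc (-1 - θ) (ρ - 1)) (hb2 : b < -(1 / 2)) :
    ∃ C : ℝ, 0 ≤ C ∧ ∀ (A B : ℝ) (G H : ℝ → ℝ), Controlled ρ θ A G → Controlled ρ θ B H →
      ∀ r : ℝ, 0 < r → KerIntegrable V (derivProdShift G H r) ∧
        |kerIntegral V (derivProdShift G H r)| ≤ C * (A * B) * r ^ (2 * b + 1) := by
  obtain ⟨C, hC0, hC⟩ := hW.exists_kerIntegral_le hα (half_mem_Icc hθ) (b := b)
    (c := b) (t := 0) (by linarith) (by norm_num) (by linarith)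
  refine ⟨C, hC0, fun A B G H hG hH r hr => ?_⟩
  obtain ⟨h1, h2⟩ := hC r r _ hr hr _ (continuousOn_derivProdShift hG hH hr.le) fun ξ η hξ hη =>
    abs_derivProdShift_le hG hH (by linarith [hρ.1, hα.1, hθ.1]) hb (by linarith) hr le_rfl hξ hη
  refine ⟨h1, h2.trans (le_of_eq ?_)⟩
  rw [← Real.rpow_add hr]; congr 2; ring

/-- Here `H'` is not shifted, so the `η`-scale is `σ = 1` and only the `ξ`-integral depends on `r`.
Near `η = 0` the integrand is of order `η^(ρ-1-a)`, whence `a < ρ`. -/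
lemma Admissible.exists_derivProd_le (hα : α ∈ Ioo (0 : ℝ) 1) (hρ : ρ ∈ Ioo (0 : ℝ) 1)
    (hW : Admissible α W V) (hθ : θ ∈ Ioo α (min ρ (1 / 2))) {a b : ℝ}
    (ha : a ∈ Icc α (1 - α)) (haρ : a < ρ) (hb : b ∈ Icc (-1 - θ) (ρ - 1)) (hab : a + b < 0) :
    ∃ C : ℝ, 0 ≤ C ∧ ∀ (A B : ℝ) (G H : ℝ → ℝ), Controlled ρ θ A G → Controlled ρ θ B H →
      ∀ r : ℝ, 0 < r → KerIntegrable V (derivProd G H r) ∧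
        |kerIntegral V (derivProd G H r)| ≤ C * (A * B) * r ^ (a + b) := by
  obtain ⟨C, hC0, hC⟩ := hW.exists_kerIntegral_le hα ha (b := b)
    (c := -(ρ + θ)) (t := 1 - ρ) hab (by linarith) (by linarith [ha.1, hα.1, hθ.1])
  refine ⟨C, hC0, fun A B G H hG hH r hr => ?_⟩
  obtain ⟨h1, h2⟩ := hC r 1 _ hr one_pos _ (continuousOn_derivProd hG hH hr.le) fun ξ η hξ hη =>
    abs_derivProd_le hG hH (by linarith [hρ.1, hα.1, hθ.1]) hb (by linarith [hb.2, hρ.2])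
      hr le_rfl hξ hη
  refine ⟨h1, h2.trans (le_of_eq ?_)⟩
  rw [Real.one_rpow, mul_one]

/-- The unit difference acts on `G'` alone and turns it into `G''`, gaining one power of `r`. The
smallest kernel exponent, `a = α`, gives the best decay. -/
lemma Admissible.exists_derivProd_sub_le (hα : α ∈ Ioo (0 : ℝ) 1) (hρ : ρ ∈ Ioo (0 : ℝ) 1)
    (hW : Admissible α W V) (hθ : θ ∈ Ioo α (min ρ (1 / 2))) :
    ∃ C : ℝ, 0 ≤ C ∧ ∀ (A B : ℝ) (G H : ℝ → ℝ), Controlled ρ θ A G → Controlled ρ θ B H →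
      ∀ r : ℝ, 0 < r →
        |kerIntegral V (fun ξ η => derivProd G H r ξ η - derivProd G H (r + 1) ξ η)| ≤
          C * (A * B) * r ^ (α - 2 - θ) := by
  have hθ2 : θ < 1 / 2 := hθ.2.trans_le (min_le_right _ _)
  have hθρ : θ < ρ := hθ.2.trans_le (min_le_left _ _)
  obtain ⟨hα0, hα1⟩ := hα
  obtain ⟨hθα, -⟩ := id hθ
  obtain ⟨C, hC0, hC⟩ := hW.exists_kerIntegral_le ⟨hα0, hα1⟩ (a := α) ⟨le_rfl, by linarith⟩
    (b := -2 - θ) (c := -(ρ + θ)) (t := 1 - ρ) (by linarith) (by linarith) (by linarith)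
  refine ⟨C, hC0, fun A B G H hG hH r hr => ?_⟩
  obtain ⟨h1, h2⟩ := hC r 1 _ hr one_pos _ ((continuousOn_derivProd hG hH hr.le).sub
    (continuousOn_derivProd hG hH (r := r + 1) (by positivity))) fun ξ η hξ hη =>
    abs_derivProd_sub_le hG hH hρ.1.le (by linarith) hr hξ hη
  refine h2.trans (le_of_eq ?_)
  rw [Real.one_rpow, mul_one]; congr 2; ring

lemma Admissible.kerIntegral_integrand₂ (hα : α ∈ Ioo (0 : ℝ) 1) (hρ : ρ ∈ Ioo (0 : ℝ) 1)
    (hW : Admissible α W V) (hθ : θ ∈ Ioo α (min ρ (1 / 2))) {A B : ℝ} {G H : ℝ → ℝ}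
    (hG : Controlled ρ θ A G) (hH : Controlled ρ θ B H) {r : ℝ} (hr : 0 < r) :
    KerIntegrable V (integrand₂ G H r) ∧ kerIntegral V (integrand₂ G H r) =
      kerIntegral V (derivProd G H r) - kerIntegral V (derivProdShift G H r) := by
  have hθ2 : θ < 1 / 2 := hθ.2.trans_le (min_le_right _ _)
  have hθρ : θ < ρ := hθ.2.trans_le (min_le_left _ _)
  have hθα := hθ.1
  have hα0 := hα.1
  have hb : -1 - θ ∈ Icc (-1 - θ) (ρ - 1) := ⟨le_rfl, by linarith⟩
  obtain ⟨C₁, -, h₁⟩ := hW.exists_derivProd_le hα hρ hθ (a := α) (b := -1 - θ)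
    ⟨le_rfl, by linarith⟩ (by linarith) hb (by linarith)
  obtain ⟨C₂, -, h₂⟩ := hW.exists_derivProdShift_le hα hρ hθ hb (by linarith)
  rw [integrand₂_eq]
  exact (h₁ A B G H hG hH r hr).1.sub (h₂ A B G H hG hH r hr).1

/-- `N[G,H]` is continuous on `(0,∞)`. -/
lemma Admissible.continuousOn_N (hα : α ∈ Ioo (0 : ℝ) 1) (hρ : ρ ∈ Ioo (0 : ℝ) 1)
    (hW : Admissible α W V) (hθ : θ ∈ Ioo α (min ρ (1 / 2))) {A B : ℝ} {G H : ℝ → ℝ}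
    (hG : Controlled ρ θ A G) (hH : Controlled ρ θ B H) : ContinuousOn (N V G H) (Ioi 0) := by
  intro r hr
  have hr : 0 < r := hr
  refine ContinuousAt.continuousWithinAt ?_
  have hθ2 : θ < 1 / 2 := hθ.2.trans_le (min_le_right _ _)
  have hθρ : θ < ρ := hθ.2.trans_le (min_le_left _ _)
  obtain ⟨hα0, hα1⟩ := id hα
  obtain ⟨hρ0, hρ1⟩ := hρ
  obtain ⟨hθα, -⟩ := id hθ
  have hA := hG.nonneg
  have hB := hH.nonneg
  -- Near `r`, majorants at `r/2` dominate all three integrands; the prefactor `x` from the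
  -- increment of `H` is at most `2r`.
  have hev : ∀ᶠ x in 𝓝 r, r / 2 < x ∧ x < 2 * r :=
    Ioo_mem_nhds (by linarith) (by linarith)
  have hr2 : 0 < r / 2 := by positivity
  have c1 : ContinuousAt (fun x => kerIntegral V (integrand₁ G H x)) r := by
    have hκ : 0 < ρ / 2 := by positivity
    refine hW.continuousAt_kerIntegral hα (half_mem_Icc hθ) (r := r / 2) (σ := r / 2)
      (M := A * B / (ρ / 2) * (2 * r)) (b := ρ / 2 - 2) (c := ρ / 2 - 1) (t := 0)
      (by linarith) (by norm_num) (by linarith) hr2 hr2 ?_ ?_ ?_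
    · filter_upwards [hev] with x hx
      exact continuousOn_integrand₁ hG hH (by linarith)
    · filter_upwards [hev] with x hx ξ η hξ hη
      refine (abs_integrand₁_le_of_holder hG hH (by linarith) (κ := ρ / 2) ⟨hκ, by linarith⟩
        (by linarith) hr2 hx.1.le hξ hη).trans ?_
      gcongr
      exact hx.2.le
    · intro ξ η hξ hη
      have := continuousAt_shift hH.continuousOn hη hr
      simp only [integrand₁, add_comm η]
      exact (continuousAt_shift hG.continuousOn_iteratedDeriv hξ hr).mul
        (continuousAt_const.sub this)
  have hb : -1 - θ ∈ Icc (-1 - θ) (ρ - 1) := ⟨le_rfl, by linarith⟩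
  have c2 : ContinuousAt (fun x => kerIntegral V (derivProd G H x)) r := by
    refine hW.continuousAt_kerIntegral hα (a := α) ⟨le_rfl, by linarith⟩ (r := r / 2) (σ := 1)
      (M := A * B) (b := -1 - θ) (c := -(ρ + θ)) (t := 1 - ρ)
      (by linarith) (by linarith) (by linarith) hr2 one_pos ?_ ?_ ?_
    · filter_upwards [hev] with x hx
      exact continuousOn_derivProd hG hH (by linarith)
    · filter_upwards [hev] with x hx ξ η hξ hη
      exact abs_derivProd_le hG hH (by linarith) hb (by linarith) hr2 hx.1.le hξ hη
    · intro ξ η hξ hη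
      exact (continuousAt_shift hG.continuousOn_deriv hξ hr).mul continuousAt_const
  have c3 : ContinuousAt (fun x => kerIntegral V (derivProdShift G H x)) r := by
    refine hW.continuousAt_kerIntegral hα (half_mem_Icc hθ) (r := r / 2) (σ := r / 2)
      (M := A * B) (b := -1 - θ) (c := -1 - θ) (t := 0)
      (by linarith) (by norm_num) (by linarith) hr2 hr2 ?_ ?_ ?_
    · filter_upwards [hev] with x hx
      exact continuousOn_derivProdShift hG hH (by linarith)
    · filter_upwards [hev] with x hx ξ η hξ hη
      exact abs_derivProdShift_le hG hH (by linarith) hb (by linarith) hr2 hx.1.le hξ hη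
    · intro ξ η hξ hη
      simp only [derivProdShift, add_comm η]
      exact (continuousAt_shift hG.continuousOn_deriv hξ hr).mul
        (continuousAt_shift hH.continuousOn_deriv hη hr)
  have c4 : ContinuousAt (fun x : ℝ => 1 / x) r := continuousAt_const.div continuousAt_id hr.ne'
  refine ((c4.mul c1).add (c4.mul (c2.sub c3))).congr ?_
  filter_upwards [Ioi_mem_nhds hr] with x hx
  rw [N, N₁, N₂, (hW.kerIntegral_integrand₂ hα ⟨hρ0, hρ1⟩ hθ hG hH hx).2]
  rfl

lemma Admissible.N_eq (hα : α ∈ Ioo (0 : ℝ) 1) (hρ : ρ ∈ Ioo (0 : ℝ) 1)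
    (hW : Admissible α W V) (hθ : θ ∈ Ioo α (min ρ (1 / 2))) {A B : ℝ} {G H : ℝ → ℝ}
    (hG : Controlled ρ θ A G) (hH : Controlled ρ θ B H) {r : ℝ} (hr : 0 < r) :
    N V G H r = (kerIntegral V (integrand₁ G H r) + kerIntegral V (derivProd G H r) -
      kerIntegral V (derivProdShift G H r)) / r := by
  rw [N, N₁, N₂, (hW.kerIntegral_integrand₂ hα hρ hθ hG hH hr).2]
  ring

/-- The size of `N[G,H]` at small arguments. -/
lemma Admissible.exists_abs_N_le (hα : α ∈ Ioo (0 : ℝ) 1) (hρ : ρ ∈ Ioo (0 : ℝ) 1)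
    (hW : Admissible α W V) (hθ : θ ∈ Ioo α (min ρ (1 / 2))) {μ : ℝ}
    (hμ : μ ∈ Ico 0 (min ρ (1 - ρ))) :
    ∃ C : ℝ, 0 ≤ C ∧ ∀ (A B : ℝ) (G H : ℝ → ℝ), Controlled ρ θ A G → Controlled ρ θ B H →
      ∀ r : ℝ, 0 < r → KerIntegrable V (integrand₁ G H r) ∧
        |N V G H r| ≤ C * (A * B) * r ^ (ρ + μ - 2) := by
  have hθ2 : θ < 1 / 2 := hθ.2.trans_le (min_le_right _ _)
  have hθρ : θ < ρ := hθ.2.trans_le (min_le_left _ _)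
  have hμρ : μ < ρ := hμ.2.trans_le (min_le_left _ _)
  have hμρ1 : μ < 1 - ρ := hμ.2.trans_le (min_le_right _ _)
  have hθα := hθ.1
  have hα0 := hα.1
  have hμ0 := hμ.1
  have hρ0 := hρ.1
  -- All exponents are chosen so that each term is of order `r^(ρ+μ-1)`. Here `κ = (ρ+μ)/2` must
  -- satisfy `κ ≤ ρ` and `κ < 1/2`, that is `μ ≤ ρ` and `μ < 1 - ρ`.
  obtain ⟨C₁, hC₁, h₁⟩ := hW.exists_integrand₁_le_of_holder hα hθ (κ := (ρ + μ) / 2)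
    ⟨by linarith, by linarith⟩ (by linarith)
  -- The sum `a + b` has to be `ρ + μ - 1` with `b ≤ ρ - 1`, which forces `a ≥ μ`; the kernel bound
  -- forces `a ≥ α`. The maximum of the two is still below `ρ`.
  obtain ⟨C₂, hC₂, h₂⟩ := hW.exists_derivProd_le hα hρ hθ (a := max α μ)
    (b := ρ - 1 + μ - max α μ) ⟨le_max_left _ _, max_le (by linarith) (by linarith)⟩
    (max_lt (by linarith) hμρ)
    ⟨by linarith [max_le_add_of_nonneg hα0.le hμ0], by linarith [le_max_right α μ]⟩ (by linarith)
  obtain ⟨C₃, hC₃, h₃⟩ := hW.exists_derivProdShift_le hα hρ hθ (b := (ρ + μ) / 2 - 1)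
    ⟨by linarith, by linarith⟩ (by linarith)
  refine ⟨C₁ + C₂ + C₃, by positivity, fun A B G H hG hH r hr => ?_⟩
  obtain ⟨i₁, h₁⟩ := h₁ A B G H hG hH r hr
  have h₂ := (h₂ A B G H hG hH r hr).2
  have h₃ := (h₃ A B G H hG hH r hr).2
  refine ⟨i₁, ?_⟩
  rw [show 2 * ((ρ + μ) / 2) - 1 = ρ + μ - 1 by ring] at h₁
  rw [show max α μ + (ρ - 1 + μ - max α μ) = ρ + μ - 1 by ring] at h₂
  rw [show 2 * ((ρ + μ) / 2 - 1) + 1 = ρ + μ - 1 by ring] at h₃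
  rw [hW.N_eq hα hρ hθ hG hH hr, abs_div, abs_of_pos hr,
    show ρ + μ - 2 = ρ + μ - 1 - 1 by ring, Real.rpow_sub_one hr.ne', mul_div_assoc']
  gcongr
  refine (abs_sub _ _).trans ((add_le_add (abs_add_le _ _) le_rfl).trans ?_)
  linarith

/-- The size of `N[G,H]` and of its unit increments at large arguments. -/
lemma Admissible.exists_abs_N_le_of_one_le (hα : α ∈ Ioo (0 : ℝ) 1) (hρ : ρ ∈ Ioo (0 : ℝ) 1)
    (hW : Admissible α W V) (hθ : θ ∈ Ioo α (min ρ (1 / 2))) :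
    ∃ C : ℝ, 0 ≤ C ∧ ∀ (A B : ℝ) (G H : ℝ → ℝ), Controlled ρ θ A G → Controlled ρ θ B H →
      ∀ r : ℝ, 1 ≤ r → |N V G H r| ≤ C * (A * B) * r ^ (α - θ - 2) ∧
        |N V G H r - N V G H (r + 1)| ≤ C * (A * B) * r ^ (-θ - 2) := by
  have hθ2 : θ < 1 / 2 := hθ.2.trans_le (min_le_right _ _)
  have hθρ : θ < ρ := hθ.2.trans_le (min_le_left _ _)
  have hθα := hθ.1
  have hα0 := hα.1
  have hb : -1 - θ ∈ Icc (-1 - θ) (ρ - 1) := ⟨le_rfl, by linarith⟩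
  obtain ⟨C₁, hC₁, h₁⟩ := hW.exists_integrand₁_le_of_decay hα hρ hθ
  obtain ⟨C₂, hC₂, h₂⟩ := hW.exists_derivProd_le hα hρ hθ (a := α) (b := -1 - θ)
    ⟨le_rfl, by linarith⟩ (by linarith) hb (by linarith)
  obtain ⟨C₃, hC₃, h₃⟩ := hW.exists_derivProdShift_le hα hρ hθ hb (by linarith)
  obtain ⟨C₄, hC₄, h₄⟩ := hW.exists_derivProd_sub_le hα hρ hθ
  refine ⟨2 * (C₁ + C₂ + C₃ + C₄), by positivity, fun A B G H hG hH => ?_⟩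
  have hAB : 0 ≤ A * B := mul_nonneg hG.nonneg hH.nonneg
  have hle : ∀ {x p q : ℝ}, 1 ≤ x → p ≤ q → x ^ p ≤ x ^ q := fun hx hpq =>
    Real.rpow_le_rpow_of_exponent_le hx hpq
  -- Only the middle term falls short of `r^(-1-θ)`, so only there is the increment exploited.
  have key : ∀ r : ℝ, 1 ≤ r →
      |kerIntegral V (integrand₁ G H r)| ≤ C₁ * (A * B) * r ^ (-1 - θ) ∧
      |kerIntegral V (derivProd G H r)| ≤ C₂ * (A * B) * r ^ (α - θ - 1) ∧
      |kerIntegral V (derivProdShift G H r)| ≤ C₃ * (A * B) * r ^ (-1 - θ) := by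
    intro r hr
    have hr0 : 0 < r := by linarith
    refine ⟨(h₁ A B G H hG hH r hr0).trans ?_, (h₂ A B G H hG hH r hr0).2.trans (le_of_eq ?_),
      (h₃ A B G H hG hH r hr0).2.trans ?_⟩
    · gcongr ?_ * ?_
      exact hle hr (by linarith)
    · congr 2; ring
    · gcongr ?_ * ?_
      exact hle hr (by linarith)
  intro r hr
  have hr0 : 0 < r := by linarith
  obtain ⟨k₁, k₂, k₃⟩ := key r hr
  obtain ⟨l₁, l₂, l₃⟩ := key (r + 1) (by linarith)
  constructor
  · rw [hW.N_eq hα hρ hθ hG hH hr0, abs_div, abs_of_pos hr0,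
      show α - θ - 2 = α - θ - 1 - 1 by ring, Real.rpow_sub_one hr0.ne', mul_div_assoc']
    gcongr
    refine (abs_sub _ _).trans ((add_le_add (abs_add_le _ _) le_rfl).trans ?_)
    have e : A * B * r ^ (-1 - θ) ≤ A * B * r ^ (α - θ - 1) :=
      mul_le_mul_of_nonneg_left (hle hr (by linarith)) hAB
    have e0 : 0 ≤ A * B * r ^ (α - θ - 1) := by positivity
    nlinarith
  · have hP : ∀ x : ℝ, 0 < x → KerIntegrable V (derivProd G H x) := fun x hx =>
      (h₂ A B G H hG hH x hx).1
    have hd := h₄ A B G H hG hH r hr0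
    rw [((hP r hr0).sub (hP (r + 1) (by positivity))).2] at hd
    rw [hW.N_eq hα hρ hθ hG hH hr0, hW.N_eq hα hρ hθ hG hH (r := r + 1) (by positivity)]
    set X₁ := kerIntegral V (integrand₁ G H r)
    set X₂ := kerIntegral V (derivProd G H r)
    set X₃ := kerIntegral V (derivProdShift G H r)
    set Y₁ := kerIntegral V (integrand₁ G H (r + 1))
    set Y₂ := kerIntegral V (derivProd G H (r + 1))
    set Y₃ := kerIntegral V (derivProdShift G H (r + 1))
    have hE : 0 ≤ A * B * r ^ (-1 - θ) := by positivity
    have hmono : (r + 1) ^ (-1 - θ) ≤ r ^ (-1 - θ) :=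
      Real.rpow_le_rpow_of_nonpos hr0 (by linarith) (by linarith)
    have hd' : |X₂ - Y₂| ≤ C₄ * (A * B) * r ^ (-1 - θ) := by
      refine hd.trans ?_
      gcongr ?_ * ?_
      exact hle hr (by linarith [hα.2])
    have hY₂ : |Y₂| / (r + 1) ≤ C₂ * (A * B) * r ^ (-1 - θ) := by
      have e1 : (r + 1) ^ (α - θ - 1) / (r + 1) ≤ r ^ (-1 - θ) := by
        rw [← Real.rpow_sub_one (by positivity)]
        exact (hle (by linarith) (by linarith [hα.2])).trans hmono
      calc |Y₂| / (r + 1) ≤ C₂ * (A * B) * (r + 1) ^ (α - θ - 1) / (r + 1) := by gcongr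
        _ = C₂ * (A * B) * ((r + 1) ^ (α - θ - 1) / (r + 1)) := by ring
        _ ≤ _ := by gcongr
    have hY₁ : |Y₁| ≤ C₁ * (A * B) * r ^ (-1 - θ) := l₁.trans (by gcongr)
    have hY₃ : |Y₃| ≤ C₃ * (A * B) * r ^ (-1 - θ) := l₃.trans (by gcongr)
    have hr1 : 0 < r + 1 := by positivity
    have hq : r / (r + 1) ≤ 1 := (div_le_one hr1).2 (by linarith)
    have hq0 : 0 ≤ r / (r + 1) := by positivity
    -- The middle terms are grouped into `X₂ - Y₂` and the contribution `Y₂/(r+1)` of the increment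
    -- of `1/r`; both gain a full power, which exceeds the deficit `α < 1`.
    have e : (X₁ + X₂ - X₃) / r - (Y₁ + Y₂ - Y₃) / (r + 1) =
        (X₁ - X₃ + (X₂ - Y₂) + Y₂ / (r + 1) - r / (r + 1) * Y₁ + r / (r + 1) * Y₃) / r := by
      field_simp; ring
    rw [e, abs_div, abs_of_pos hr0, show -θ - 2 = -1 - θ - 1 by ring, Real.rpow_sub_one hr0.ne',
      mul_div_assoc']
    gcongr
    have t : ∀ a b c d e f : ℝ, |a - b + c + d - e + f| ≤ |a| + |b| + |c| + |d| + |e| + |f| := by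
      intro a b c d e f
      simp only [abs_le]
      constructor <;> linarith [neg_abs_le a, neg_abs_le b, neg_abs_le c, neg_abs_le d,
        neg_abs_le e, neg_abs_le f, le_abs_self a, le_abs_self b, le_abs_self c, le_abs_self d,
        le_abs_self e, le_abs_self f]
    refine (t _ _ _ _ _ _).trans ?_
    have u₁ : |r / (r + 1) * Y₁| ≤ |Y₁| := by
      rw [abs_mul, abs_of_nonneg hq0]; exact mul_le_of_le_one_left (abs_nonneg _) hq
    have u₃ : |r / (r + 1) * Y₃| ≤ |Y₃| := by
      rw [abs_mul, abs_of_nonneg hq0]; exact mul_le_of_le_one_left (abs_nonneg _) hq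
    have u₂ : |Y₂ / (r + 1)| = |Y₂| / (r + 1) := by rw [abs_div, abs_of_pos hr1]
    have v₂ : 0 ≤ C₂ * (A * B) * r ^ (-1 - θ) := by positivity
    have v₄ : 0 ≤ C₄ * (A * B) * r ^ (-1 - θ) := by positivity
    rw [u₂]
    linarith

end KernelBounds

/-! ### Tail integrals and the final estimate -/

/-- The tail integral of a function. -/
def tail (f : ℝ → ℝ) (p : ℝ) : ℝ := ∫ r in Ioi p, f r

lemma hasDerivAt_tail {f : ℝ → ℝ} (hf : ContinuousOn f (Ioi 0))
    (hi : ∀ p : ℝ, 0 < p → IntegrableOn f (Ioi p)) {p : ℝ} (hp : 0 < p) :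
    HasDerivAt (tail f) (-f p) p := by
  have hp2 : 0 < p / 2 := by positivity
  have hint : IntervalIntegrable f volume (p / 2) p :=
    (intervalIntegrable_iff_integrableOn_Ioc_of_le (by linarith)).2
      ((hi _ hp2).mono_set Ioc_subset_Ioi_self)
  have h1 := intervalIntegral.integral_hasDerivAt_right hint
    (hf.stronglyMeasurableAtFilter isOpen_Ioi p hp) (hf.continuousAt (Ioi_mem_nhds hp))
  refine (h1.const_sub (tail f (p / 2))).congr_of_eventuallyEq ?_
  filter_upwards [Ioi_mem_nhds hp] with x hx
  rw [← intervalIntegral.integral_Ioi_sub_Ioi' (hi _ hp2) (hi x hx)]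
  simp [tail]

lemma abs_tail_sub_tail_add_one_le {f : ℝ → ℝ} {p M : ℝ}
    (hi : IntegrableOn f (Ioi p)) (hM : ∀ r : ℝ, p < r → |f r| ≤ M) :
    |tail f p - tail f (p + 1)| ≤ M := by
  rw [tail, tail, intervalIntegral.integral_Ioi_sub_Ioi hi (by linarith)]
  have := intervalIntegral.norm_integral_le_of_norm_le_const (a := p) (b := p + 1) (f := f)
    (C := M) fun x hx => hM x (by rw [uIoc_of_le (by linarith)] at hx; exact hx.1)
  simpa using this

lemma integrableOn_and_abs_tail_le {f : ℝ → ℝ} (hf : ContinuousOn f (Ioi 0)) {p b K : ℝ}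
    (hp : 0 < p) (hb : b < -1) (hK : ∀ r : ℝ, p < r → |f r| ≤ K * r ^ b) :
    IntegrableOn f (Ioi p) ∧ |tail f p| ≤ K * (p ^ (b + 1) / -(b + 1)) := by
  have hmaj : IntegrableOn (fun r : ℝ => K * r ^ b) (Ioi p) :=
    (integrableOn_Ioi_rpow_of_lt hb hp).const_mul K
  have hle : ∀ᵐ r ∂(volume.restrict (Ioi p)), ‖f r‖ ≤ K * r ^ b := by
    filter_upwards [ae_restrict_mem measurableSet_Ioi] with r hr using hK r hr
  refine ⟨hmaj.mono' ((hf.mono (Ioi_subset_Ioi hp.le)).aestronglyMeasurable measurableSet_Ioi)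
    hle, ?_⟩
  have := norm_integral_le_of_norm_le hmaj hle
  rw [integral_const_mul, integral_Ioi_rpow_of_lt hb hp] at this
  refine this.trans (le_of_eq ?_)
  rw [div_neg, neg_div]

lemma integrableOn_and_integral_abs_le {f : ℝ → ℝ} (hf : ContinuousOn f (Ioi 0)) {s b K : ℝ}
    (hs : 0 < s) (hb : b < -1) (hK0 : ∀ r : ℝ, 0 < r → |f r| ≤ K * r ^ (s - 1))
    (hK1 : ∀ r : ℝ, 1 ≤ r → |f r| ≤ K * r ^ b) :
    IntegrableOn f (Ioi 0) ∧ ∫ r in Ioi (0 : ℝ), |f r| ≤ K * (1 / s + 1 / -(b + 1)) := by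
  have hm0 : IntegrableOn (fun r : ℝ => K * r ^ (s - 1)) (Ioc 0 1) :=
    Integrable.const_mul ((intervalIntegrable_iff_integrableOn_Ioc_of_le zero_le_one).1
      (intervalIntegral.intervalIntegrable_rpow' (by linarith))) K
  have hm1 : IntegrableOn (fun r : ℝ => K * r ^ b) (Ioi 1) :=
    (integrableOn_Ioi_rpow_of_lt hb zero_lt_one).const_mul K
  have hl0 : ∀ᵐ r ∂(volume.restrict (Ioc (0 : ℝ) 1)), ‖f r‖ ≤ K * r ^ (s - 1) := by
    filter_upwards [ae_restrict_mem measurableSet_Ioc] with r hr using hK0 r hr.1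
  have hl1 : ∀ᵐ r ∂(volume.restrict (Ioi (1 : ℝ))), ‖f r‖ ≤ K * r ^ b := by
    filter_upwards [ae_restrict_mem measurableSet_Ioi] with r hr using hK1 r (le_of_lt hr)
  have i0 : IntegrableOn f (Ioc 0 1) := hm0.mono'
    ((hf.mono Ioc_subset_Ioi_self).aestronglyMeasurable measurableSet_Ioc) hl0
  have i1 : IntegrableOn f (Ioi 1) := hm1.mono'
    ((hf.mono (Ioi_subset_Ioi zero_le_one)).aestronglyMeasurable measurableSet_Ioi) hl1
  rw [← Ioc_union_Ioi_eq_Ioi (zero_le_one (α := ℝ))]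
  refine ⟨i0.union i1, ?_⟩
  rw [setIntegral_union Ioc_disjoint_Ioi_same measurableSet_Ioi i0.abs i1.abs, mul_add]
  have e0 : ∫ r in Ioc (0 : ℝ) 1, K * r ^ (s - 1) = K * (1 / s) := by
    rw [integral_const_mul, ← intervalIntegral.integral_of_le zero_le_one,
      integral_rpow (Or.inl (by linarith)), sub_add_cancel, Real.one_rpow,
      Real.zero_rpow hs.ne', sub_zero]
  have e1 : ∫ r in Ioi (1 : ℝ), K * r ^ b = K * (1 / -(b + 1)) := by
    rw [integral_const_mul, integral_Ioi_rpow_of_lt hb zero_lt_one, Real.one_rpow, div_neg,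
      neg_div]
  rw [← e0, ← e1]
  exact add_le_add (integral_mono_ae i0.abs hm0 hl0) (integral_mono_ae i1.abs hm1 hl1)

lemma abs_tail_le_of_integrableOn {f : ℝ → ℝ} (hi : IntegrableOn f (Ioi 0)) {q : ℝ}
    (hq : 0 ≤ q) : |tail f q| ≤ ∫ r in Ioi (0 : ℝ), |f r| :=
  (abs_integral_le_integral_abs).trans
    (setIntegral_mono_set hi.abs (ae_of_all _ fun _ => abs_nonneg _)
      (Ioi_subset_Ioi hq).eventuallyLE)

/-- Up to a constant the weight is `q^(k-ρ-ν)` for `q ≤ 1` and `q^(χ+k)` for `q ≥ 1`. The bound `χ +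
ν + ρ ≤ 2` makes `2^2 = 4` a sufficient constant. -/
lemma seminormX_le {ρ ν χ K : ℝ} {k : ℕ} {F : ℝ → ℝ} (hE : 0 ≤ χ + ν + ρ)
    (hE2 : χ + ν + ρ ≤ 2) (h0 : ∀ q : ℝ, 0 < q → q ≤ 1 →
      |iteratedDeriv k F q| ≤ K * q ^ (ρ + ν - k))
    (h1 : ∀ q : ℝ, 1 ≤ q → |iteratedDeriv k F q| ≤ K * q ^ (-χ - k)) :
    seminormX ρ k ν χ F ≤ ENNReal.ofReal (4 * K) := by
  refine iSup₂_le fun q hq => ENNReal.ofReal_le_ofReal ?_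
  have hq : 0 < q := hq
  have h4 : (2 : ℝ) ^ (χ + ν + ρ) ≤ 4 := by
    calc (2 : ℝ) ^ (χ + ν + ρ) ≤ 2 ^ (2 : ℝ) :=
          Real.rpow_le_rpow_of_exponent_le (by norm_num) hE2
      _ = 4 := by norm_num
  rcases le_total q 1 with h | h
  · have e1 : (1 + q) ^ (χ + ν + ρ) ≤ 4 :=
      (Real.rpow_le_rpow (by positivity) (by linarith) hE).trans h4
    have e2 : q ^ ((k : ℝ) - ρ - ν) * q ^ (ρ + ν - k) = 1 := by
      rw [← Real.rpow_add hq, show (k : ℝ) - ρ - ν + (ρ + ν - k) = 0 by ring, Real.rpow_zero]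
    calc _ ≤ 4 * q ^ ((k : ℝ) - ρ - ν) * (K * q ^ (ρ + ν - k)) := by
          gcongr
          exact h0 q hq h
      _ = 4 * K * (q ^ ((k : ℝ) - ρ - ν) * q ^ (ρ + ν - k)) := by ring
      _ = 4 * K := by rw [e2, mul_one]
  · have e1 : (1 + q) ^ (χ + ν + ρ) ≤ 4 * q ^ (χ + ν + ρ) := by
      calc (1 + q) ^ (χ + ν + ρ) ≤ (2 * q) ^ (χ + ν + ρ) :=
            Real.rpow_le_rpow (by positivity) (by linarith) hE
        _ = 2 ^ (χ + ν + ρ) * q ^ (χ + ν + ρ) := Real.mul_rpow (by norm_num) hq.le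
        _ ≤ _ := by gcongr
    have e2 : q ^ (χ + ν + ρ) * q ^ ((k : ℝ) - ρ - ν) * q ^ (-χ - k) = 1 := by
      rw [← Real.rpow_add hq, ← Real.rpow_add hq,
        show χ + ν + ρ + ((k : ℝ) - ρ - ν) + (-χ - k) = 0 by ring, Real.rpow_zero]
    calc _ ≤ 4 * q ^ (χ + ν + ρ) * q ^ ((k : ℝ) - ρ - ν) * (K * q ^ (-χ - k)) := by
          gcongr
          exact h1 q h
      _ = 4 * K * (q ^ (χ + ν + ρ) * q ^ ((k : ℝ) - ρ - ν) * q ^ (-χ - k)) := by ring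
      _ = 4 * K := by rw [e2, mul_one]

/-- The differenced double tail integral of a function with the decay of `N[G,H]`. -/
lemma normX_tail_tail_sub_le {ρ θ μ α K : ℝ} {n : ℝ → ℝ} (hα : 0 < α) (hαθ : α < θ)
    (hθ : θ < 1 / 2) (hρ : 0 < ρ) (hμ : 0 ≤ μ) (hρμ : ρ + μ < 1) (hK : 0 ≤ K)
    (hn : ContinuousOn n (Ioi 0)) (hn0 : ∀ r : ℝ, 0 < r → |n r| ≤ K * r ^ (ρ + μ - 2))
    (hn1 : ∀ r : ℝ, 1 ≤ r → |n r| ≤ K * r ^ (α - θ - 2))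
    (hn2 : ∀ r : ℝ, 1 ≤ r → |n r - n (r + 1)| ≤ K * r ^ (-θ - 2)) :
    (∀ p : ℝ, 0 < p → IntegrableOn n (Ioi p)) ∧ IntegrableOn (tail n) (Ioi 0) ∧
    ContDiffOn ℝ 2 (fun q => tail (tail n) q - tail (tail n) (q + 1)) (Ioi 0) ∧
    ContinuousOn (fun q => tail (tail n) q - tail (tail n) (q + 1)) (Ici 0) ∧
    normX ρ 2 μ θ (fun q => tail (tail n) q - tail (tail n) (q + 1)) ≤
      ENNReal.ofReal
        (24 * (1 / (1 - ρ - μ) * (1 / (ρ + μ) + 1 / (θ - α)) + 1 / (1 - ρ - μ)) * K) := by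
  -- `c` comes from integrating `r^(ρ+μ-2)` over `(p, ∞)`; `d` comes from integrating `p^(ρ+μ-1)`
  -- over `(0, 1)` and `p^(α-θ-1)` over `(1, ∞)`.
  set c : ℝ := 1 / (1 - ρ - μ) with hc
  set d : ℝ := 1 / (ρ + μ) + 1 / (θ - α) with hd
  have hc1 : 1 ≤ c := by
    rw [hc, le_div_iff₀ (by linarith)]; linarith
  have hd0 : 0 ≤ d := by
    have h1 : 0 < ρ + μ := by linarith
    have h2 : 0 < θ - α := by linarith
    positivity
  have hi : ∀ p : ℝ, 0 < p → IntegrableOn n (Ioi p) := fun p hp =>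
    (integrableOn_and_abs_tail_le hn hp (b := ρ + μ - 2) (by linarith)
      fun r hr => hn0 r (hp.trans hr)).1
  have hT0 : ∀ p : ℝ, 0 < p → |tail n p| ≤ c * K * p ^ (ρ + μ - 1) := fun p hp => by
    refine ((integrableOn_and_abs_tail_le hn hp (b := ρ + μ - 2) (by linarith)
      fun r hr => hn0 r (hp.trans hr)).2).trans (le_of_eq ?_)
    rw [hc, show -(ρ + μ - 2 + 1) = 1 - ρ - μ by ring, show ρ + μ - 2 + 1 = ρ + μ - 1 by ring]
    ring
  have hT1 : ∀ p : ℝ, 1 ≤ p → |tail n p| ≤ c * K * p ^ (α - θ - 1) := fun p hp => by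
    have hp0 : 0 < p := by linarith
    refine ((integrableOn_and_abs_tail_le hn hp0 (b := α - θ - 2) (by linarith)
      fun r hr => hn1 r (hp.trans hr.le)).2).trans ?_
    rw [show -(α - θ - 2 + 1) = 1 + θ - α by ring, show α - θ - 2 + 1 = α - θ - 1 by ring]
    calc K * (p ^ (α - θ - 1) / (1 + θ - α)) ≤ K * p ^ (α - θ - 1) := by
          gcongr
          exact div_le_self (by positivity) (by linarith)
      _ = 1 * (K * p ^ (α - θ - 1)) := (one_mul _).symm
      _ ≤ c * (K * p ^ (α - θ - 1)) := by gcongr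
      _ = _ := by ring
  have hTd : ∀ p : ℝ, 0 < p → HasDerivAt (tail n) (-n p) p := fun p hp => hasDerivAt_tail hn hi hp
  have hTc : ContinuousOn (tail n) (Ioi 0) := fun p hp =>
    (hTd p hp).continuousAt.continuousWithinAt
  obtain ⟨hTi, hTI⟩ := integrableOn_and_integral_abs_le hTc (s := ρ + μ) (b := α - θ - 1)
    (K := c * K) (by linarith) (by linarith) hT0 hT1
  rw [show -(α - θ - 1 + 1) = θ - α by ring, ← hd] at hTI
  have hTip : ∀ p : ℝ, 0 ≤ p → IntegrableOn (tail n) (Ioi p) := fun p hp =>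
    hTi.mono_set (Ioi_subset_Ioi hp)
  have hBd : ∀ p : ℝ, 0 < p → HasDerivAt (tail (tail n)) (-tail n p) p := fun p hp =>
    hasDerivAt_tail hTc (fun p hp => hTip p hp.le) hp
  have hBc : ContinuousOn (tail (tail n)) (Ici 0) := hTi.continuousOn_Ici_primitive_Ioi
  set F : ℝ → ℝ := fun q => tail (tail n) q - tail (tail n) (q + 1) with hF
  have hFd : ∀ q : ℝ, 0 < q → HasDerivAt F (tail n (q + 1) - tail n q) q := fun q hq => by
    have h := (hBd q hq).sub ((hBd (q + 1) (by positivity)).comp_add_const q 1)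
    exact HasDerivAt.congr_deriv (f := F) h (by ring)
  have hF1 : EqOn (deriv F) (fun q => tail n (q + 1) - tail n q) (Ioi 0) :=
    fun q hq => (hFd q hq).deriv
  have hFd2 : ∀ q : ℝ, 0 < q → HasDerivAt (deriv F) (n q - n (q + 1)) q := fun q hq => by
    have h := ((hTd (q + 1) (by positivity)).comp_add_const q 1).sub (hTd q hq)
    refine HasDerivAt.congr_of_eventuallyEq (f := fun q => tail n (q + 1) - tail n q) ?_
      (hF1.eventuallyEq_of_mem (Ioi_mem_nhds hq))
    exact HasDerivAt.congr_deriv (f := fun q => tail n (q + 1) - tail n q) h (by ring)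
  have hF2 : EqOn (deriv (deriv F)) (fun q => n q - n (q + 1)) (Ioi 0) :=
    fun q hq => (hFd2 q hq).deriv
  have hi2 : iteratedDeriv 2 F = deriv (deriv F) := by
    rw [iteratedDeriv_succ, iteratedDeriv_one]
  have hshift : ContinuousOn (fun q => n (q + 1)) (Ioi 0) :=
    hn.comp (f := fun q => q + 1) (by fun_prop) fun q hq => by
      have : 0 < q := hq
      exact mem_Ioi.2 (by positivity)
  have hcd : ContDiffOn ℝ 2 F (Ioi 0) := by
    rw [show (2 : WithTop ℕ∞) = 1 + 1 by norm_num, contDiffOn_succ_iff_deriv_of_isOpen isOpen_Ioi]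
    refine ⟨fun q hq => (hFd q hq).differentiableAt.differentiableWithinAt, by simp, ?_⟩
    rw [show (1 : WithTop ℕ∞) = 0 + 1 by norm_num, contDiffOn_succ_iff_deriv_of_isOpen isOpen_Ioi]
    refine ⟨fun q hq => (hFd2 q hq).differentiableAt.differentiableWithinAt, by simp, ?_⟩
    rw [contDiffOn_zero]
    exact (hn.sub hshift).congr hF2
  have hFc : ContinuousOn F (Ici 0) := by
    refine hBc.sub (hBc.comp (f := fun q => q + 1) (by fun_prop) fun q hq => ?_)
    have : 0 ≤ q := hq
    exact mem_Ici.2 (by positivity)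
  refine ⟨hi, hTi, hcd, hFc, ?_⟩
  have hcK : 0 ≤ c * K := by positivity
  have hle : ∀ {x p q : ℝ}, 1 ≤ x → p ≤ q → x ^ p ≤ x ^ q := fun hx hpq =>
    Real.rpow_le_rpow_of_exponent_le hx hpq
  have hM : 0 ≤ 2 * (c * d + c) * K := by positivity
  have hKM : 2 * K ≤ 2 * (c * d + c) * K := by
    have : 1 ≤ c * d + c := by nlinarith
    nlinarith
  have hcKM : 2 * (c * K) ≤ 2 * (c * d + c) * K := by
    have : 0 ≤ c * d * K := by positivity
    nlinarith
  have hanti : ∀ {x y p : ℝ}, 0 < x → x ≤ y → p ≤ 0 → y ^ p ≤ x ^ p := fun hx hxy hp =>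
    Real.rpow_le_rpow_of_nonpos hx hxy hp
  have s0 : seminormX ρ 0 (-ρ) θ F ≤ ENNReal.ofReal (4 * (2 * (c * d + c) * K)) := by
    refine seminormX_le (by linarith) (by linarith) (fun q hq _ => ?_) fun q hq => ?_
    · rw [iteratedDeriv_zero, add_neg_cancel, Nat.cast_zero, sub_zero, Real.rpow_zero, mul_one]
      have h1 := abs_tail_le_of_integrableOn hTi hq.le
      have h2 := abs_tail_le_of_integrableOn hTi (q := q + 1) (by positivity)
      have h3 := abs_sub (tail (tail n) q) (tail (tail n) (q + 1))
      have h4 : |F q| ≤ 2 * (c * K * d) := h3.trans (by linarith)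
      have : 2 * (c * d + c) * K = 2 * (c * K * d) + 2 * (c * K) := by ring
      linarith
    · rw [iteratedDeriv_zero, Nat.cast_zero, sub_zero]
      -- A unit-interval integral of `tail n` is of order `q^(α-θ-1)`, which is at most `q^(-θ)`.
      -- The bound on `F` by twice the integral of `|tail n|` would give no decay.
      refine abs_tail_sub_tail_add_one_le (hTip q (by linarith)) fun r hr => ?_
      refine (hT1 r (by linarith)).trans ?_
      calc c * K * r ^ (α - θ - 1) ≤ c * K * q ^ (α - θ - 1) := by
            gcongr ?_ * ?_
            exact hanti (by linarith) hr.le (by linarith)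
        _ ≤ c * K * q ^ (-θ) := by
            gcongr ?_ * ?_
            exact hle hq (by linarith)
        _ ≤ _ := by
            gcongr ?_ * ?_
            linarith
  have s1 : seminormX ρ 1 μ θ F ≤ ENNReal.ofReal (4 * (2 * (c * d + c) * K)) := by
    refine seminormX_le (by linarith) (by linarith) (fun q hq _ => ?_) fun q hq => ?_
    · rw [iteratedDeriv_one, hF1 hq, Nat.cast_one]
      have h1 := hT0 q hq
      have h2 := hT0 (q + 1) (by positivity)
      have h3 := abs_sub (tail n (q + 1)) (tail n q)
      have h4 : c * K * (q + 1) ^ (ρ + μ - 1) ≤ c * K * q ^ (ρ + μ - 1) := by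
        gcongr ?_ * ?_
        exact hanti hq (by linarith) (by linarith)
      have h5 : 2 * (c * K) * q ^ (ρ + μ - 1) ≤ 2 * (c * d + c) * K * q ^ (ρ + μ - 1) := by
        gcongr
      refine h3.trans (le_trans ?_ h5)
      linarith
    · have hq0 : 0 < q := by linarith
      rw [iteratedDeriv_one, hF1 hq0, Nat.cast_one, abs_sub_comm]
      refine abs_tail_sub_tail_add_one_le (hi q hq0) fun r hr => ?_
      refine (hn1 r (by linarith)).trans ?_
      calc K * r ^ (α - θ - 2) ≤ K * q ^ (α - θ - 2) := by
            gcongr ?_ * ?_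
            exact hanti hq0 hr.le (by linarith)
        _ ≤ K * q ^ (-θ - 1) := by
            gcongr ?_ * ?_
            exact hle hq (by linarith)
        _ ≤ _ := by
            gcongr ?_ * ?_
            linarith
  have s2 : seminormX ρ 2 μ θ F ≤ ENNReal.ofReal (4 * (2 * (c * d + c) * K)) := by
    refine seminormX_le (by linarith) (by linarith) (fun q hq _ => ?_) fun q hq => ?_
    · rw [hi2, hF2 hq, Nat.cast_ofNat]
      have h1 := hn0 q hq
      have h2 := hn0 (q + 1) (by positivity)
      have h3 := abs_sub (n q) (n (q + 1))
      have h4 : K * (q + 1) ^ (ρ + μ - 2) ≤ K * q ^ (ρ + μ - 2) := by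
        gcongr ?_ * ?_
        exact hanti hq (by linarith) (by linarith)
      have h5 : 2 * K * q ^ (ρ + μ - 2) ≤ 2 * (c * d + c) * K * q ^ (ρ + μ - 2) := by
        gcongr ?_ * ?_
      refine h3.trans (le_trans ?_ h5)
      linarith
    · have hq0 : 0 < q := by linarith
      rw [hi2, hF2 hq0, Nat.cast_ofNat]
      -- The separate bounds on `n q` and `n (q + 1)` would lose a factor `q^α` here. No derivative
      -- of `n` is available, so the increment bound is an input.
      refine (hn2 q hq).trans ?_
      gcongr ?_ * ?_
      linarith
  have hsum : normX ρ 2 μ θ F =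
      seminormX ρ 0 (-ρ) θ F + (seminormX ρ 1 μ θ F + seminormX ρ 2 μ θ F) := by
    rw [normX, show Finset.Icc 1 2 = ({1, 2} : Finset ℕ) from rfl, Finset.sum_pair (by norm_num)]
  rw [hsum]
  refine (add_le_add s0 (add_le_add s1 s2)).trans (le_of_eq ?_)
  -- Three seminorms, each at most `8 (cd + c) K`, give the factor `24`.
  rw [← ENNReal.ofReal_add (by positivity) (by positivity),
    ← ENNReal.ofReal_add (by positivity) (by positivity)]
  congr 1; ring

end FatTail

end

/-! ### The proposition: assembly of the bounds. -/

theorem proposition3p3 (α ρ θ μ : ℝ) (hα : α ∈ Set.Ioo (0 : ℝ) 1) (hρ : ρ ∈ Set.Ioo (0 : ℝ) 1)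
    (hθ : θ ∈ Set.Ioo α (min ρ (1 / 2))) (hμ : μ ∈ Set.Ico 0 (min ρ (1 - ρ)))
    (W : ℝ → ℝ → ℝ) (V : ℂ → ℂ) (hW : FatTail.Admissible α W V) :
    ∃ C : ℝ, 0 < C ∧ ∀ G ∈ FatTail.X ρ 2 0 θ, ∀ H ∈ FatTail.X ρ 2 0 θ,
      FatTail.BWWellDefined V G H ∧
      (fun q : ℝ => FatTail.BW V G H q - FatTail.BW V G H (q + 1)) ∈ FatTail.X ρ 2 μ θ ∧
      FatTail.normX ρ 2 μ θ (fun q : ℝ => FatTail.BW V G H q - FatTail.BW V G H (q + 1)) ≤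
        ENNReal.ofReal C * FatTail.normX ρ 2 0 θ G * FatTail.normX ρ 2 0 θ H := by
  obtain ⟨C₁, hC₁, h₁⟩ := hW.exists_abs_N_le hα hρ hθ hμ
  obtain ⟨C₂, hC₂, h₂⟩ := hW.exists_abs_N_le_of_one_le hα hρ hθ
  have hθ2 : θ < 1 / 2 := hθ.2.trans_le (min_le_right _ _)
  have hμρ : μ < 1 - ρ := hμ.2.trans_le (min_le_right _ _)
  set c : ℝ := 24 * (1 / (1 - ρ - μ) * (1 / (ρ + μ) + 1 / (θ - α)) + 1 / (1 - ρ - μ)) with hc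
  have hc0 : 0 < c := by
    have e1 : 0 < 1 - ρ - μ := by linarith
    have e2 : 0 < ρ + μ := by linarith [hρ.1, hμ.1]
    have e3 : 0 < θ - α := by linarith [hθ.1]
    positivity
  -- The summand `1` keeps the constant positive even if `C₁ = C₂ = 0`.
  refine ⟨c * (C₁ + C₂ + 1), by positivity, fun G hG H hH => ?_⟩
  have kG := FatTail.controlled_of_mem_X hG
  have kH := FatTail.controlled_of_mem_X hH
  set A : ℝ := (FatTail.normX ρ 2 0 θ G).toReal with hA
  set B : ℝ := (FatTail.normX ρ 2 0 θ H).toReal with hB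
  have hAB : 0 ≤ A * B := mul_nonneg kG.nonneg kH.nonneg
  set K : ℝ := (C₁ + C₂ + 1) * (A * B) with hK
  have hK₁ : C₁ * (A * B) ≤ K := by rw [hK]; gcongr; linarith
  have hK₂ : C₂ * (A * B) ≤ K := by rw [hK]; gcongr; linarith
  -- `BW V G H` is `tail (tail (N V G H))` by definition, so these conclusions apply to it directly.
  obtain ⟨hi, hTi, hcd, hcont, hnorm⟩ := FatTail.normX_tail_tail_sub_le (K := K) hα.1 hθ.1 hθ2
    hρ.1 hμ.1 (by linarith) (by positivity) (hW.continuousOn_N hα hρ hθ kG kH)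
    (fun r hr => ((h₁ A B G H kG kH r hr).2).trans (by gcongr))
    (fun r hr => ((h₂ A B G H kG kH r hr).1).trans (by gcongr))
    (fun r hr => ((h₂ A B G H kG kH r hr).2).trans (by gcongr))
  refine ⟨⟨fun r hr => ⟨(h₁ A B G H kG kH r hr).1,
    (hW.kerIntegral_integrand₂ hα hρ hθ kG kH hr).1⟩, hi, hTi⟩,
    ⟨hcd, hcont, hnorm.trans_lt ENNReal.ofReal_lt_top⟩, hnorm.trans (le_of_eq ?_)⟩
  rw [← ENNReal.ofReal_toReal hG.2.2.ne, ← ENNReal.ofReal_toReal hH.2.2.ne, ← hA, ← hB,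
    ← ENNReal.ofReal_mul (by positivity), ← ENNReal.ofReal_mul (by have := kG.nonneg; positivity)]
  congr 1
  rw [hK, hc]; ring
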